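/- **Lemma (Gauss' Lemma for finitely-connected tori).** Let $\tau\in\mathbb C$ with $b=\operatorname{Im}\tau>0$, let $\Lambda_\tau=\mathbb Z+\mathbb Z\tau$ and $\mathbb T_\tau=\mathbb C/\Lambda_\tau$ (with its flat metric). Let $D_1,\dots,D_M\subset\mathbb C$ be bounded, open, simply connected sets with $C^2$ boundary (near each boundary point, $D_j$ is the set where a real $C^2$ function with non-vanishing differential is positive) whose closures are mapped injectively into $\mathbb T_\tau$ and have pairwise disjoint images there; we identify each $D_j$ with its image in $\mathbb T_\tau$. Put $D=\bigcup_{j=1}^M D_j$, $\Omega=\mathbb T_\tau\setminus\overline D$, $\partial\Omega=\bigcup_j\partial D_j$, let $|D_j|$ be the area of $D_j$ and $|D|=\sum_j|D_j|$, and let $\nu(\xi)$ be the unit normal vector at $\xi\in\partial\Omega$ pointing into $D$. Let $$G(z)=-\frac1{2\pi}\log|\vartheta_1(z)|+\frac{(\operatorname{Im}z)^2}{2b},\qquad \vartheta_1(z)=-i\sum_{n\in\mathbb Z}(-1)^n e^{\pi i\tau(n+\frac12)^2}e^{(2n+1)\pi i z},$$ let $\partial_{\nu_\xi}G(z-\xi)$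 be the derivative of $\xi\mapsto G(z-\xi)$ in the direction $\nu(\xi)$, and let $|d\xi|$ be arc length. Then, for each $j=1,\dots,M$, $$\int_{\partial D_j}\partial_{\nu_\xi}G(z-\xi)\,|d\xi|=\begin{cases}-\dfrac{|D_j|}b & \text{if } z\in\mathbb T_\tau\setminus\overline{D_j},\\[1ex] 1-\dfrac{|D_j|}b & \text{if } z\in D_j,\\[1ex] \dfrac12-\dfrac{|D_j|}b & \text{if } z\in\partial D_j,\end{cases}$$ and $$\int_{\partial\Omega}\partial_{\nu_\xi}G(z-\xi)\,|d\xi|=\begin{cases}-\dfrac{|D|}b & \text{if } z\in\Omega,\\[1ex] 1-\dfrac{|D|}b & \text{if } z\in D,\\[1ex] \dfrac12-\dfrac{|D|}b & \text{if } z\in\partial\Omega.\end{cases}$$ In the first two cases of each formula the integrals converge absolutely; when $z\in\partial D_j$ (respectively $z\in\partial\Omega$) the integral is a principal value, namely the limit as $\varepsilon\to0^+$ of the (absolutely convergent) integral over the part of the curve at distance more than $\varepsilon$ from $z$ in $\mathbb T_\tau$. -/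

import Mathlib

open MeasureTheory Topology Filter

noncomputable section

/-- The lattice `ℤ + ℤ τ`. -/
def periodLattice (τ : ℂ) : AddSubgroup ℂ := AddSubgroup.closure {1, τ}

/-- The flat torus `ℂ / (ℤ + ℤ τ)`, with Mathlib's quotient topology and quotient distance
`dist [z] [ξ] = inf {‖z - ξ - l‖ : l ∈ ℤ + ℤ τ}`. -/
abbrev FlatTorus (τ : ℂ) : Type := ℂ ⧸ periodLattice τ

/-- The projection `ℂ → ℂ / (ℤ + ℤ τ)`. -/
def toTorus (τ : ℂ) (z : ℂ) : FlatTorus τ := QuotientAddGroup.mk z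

/-- The Jacobi theta function
`ϑ₁(z) = -i ∑_{n ∈ ℤ} (-1)^n q^((n + 1/2)^2) e^((2n + 1) π i z)` with `q = e^(π i τ)`. -/
def jacobiThetaOne (τ z : ℂ) : ℂ :=
  -Complex.I * ∑' n : ℤ, (-1 : ℂ) ^ n
    * Complex.exp (Real.pi * Complex.I * τ * ((n : ℂ) + 1 / 2) ^ 2)
    * Complex.exp ((2 * (n : ℂ) + 1) * Real.pi * Complex.I * z)

/-- The Green's function `G(z) = -(1 / 2π) log |ϑ₁(z)| + (Im z)^2 / (2b)`, `b = Im τ`, of the torus,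
as a function of a representative `z ∈ ℂ` (only its values off the lattice matter). -/
def greenFunction (τ z : ℂ) : ℝ :=
  -(1 / (2 * Real.pi)) * Real.log ‖jacobiThetaOne τ z‖ + z.im ^ 2 / (2 * τ.im)

/-- The set `D` has a boundary of class `C²`: near each boundary point, `D` is the set where a
`C²` function with nonzero differential is positive. -/
def HasC2Boundary (D : Set ℂ) : Prop :=
  ∀ p ∈ frontier D, ∃ U : Set ℂ, IsOpen U ∧ p ∈ U ∧ ∃ ρ : ℂ → ℝ,
    ContDiffOn ℝ 2 ρ U ∧ (∀ ξ ∈ U, fderiv ℝ ρ ξ ≠ 0) ∧ D ∩ U = {ξ ∈ U | 0 < ρ ξ}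

/-- `n` is the unit vector at the boundary point `ξ` of `D` that is normal to `∂D` and points into
`D`. Here `Re (v * conj n)` is the real inner product of `v` and `n`; the second clause says that
`n` is orthogonal to the tangent line of `∂D` at `ξ`. -/
def IsInnerUnitNormal (D : Set ℂ) (ξ n : ℂ) : Prop :=
  ‖n‖ = 1 ∧
  (fun w : ℂ => ((w - ξ) * starRingEnd ℂ n).re) =o[𝓝[frontier D] ξ] (fun w : ℂ => w - ξ) ∧
  ∀ᶠ t : ℝ in 𝓝[>] 0, ξ + (t : ℂ) * n ∈ D

/-- The holes `D j ⊆ ℂ` of a finitely-connected torus: bounded, open, simply connected, with `C²`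
boundary, such that the closures embed in the torus and are disjoint there. -/
structure IsHoleFamily (τ : ℂ) {M : ℕ} (D : Fin M → Set ℂ) : Prop where
  isOpen : ∀ j, IsOpen (D j)
  isBounded : ∀ j, Bornology.IsBounded (D j)
  simplyConnected : ∀ j, IsSimplyConnected (D j)
  hasC2Boundary : ∀ j, HasC2Boundary (D j)
  injOn_closure : ∀ j, Set.InjOn (toTorus τ) (closure (D j))
  disjoint_closure : ∀ i j, i ≠ j →
    Disjoint (closure (toTorus τ '' D i)) (closure (toTorus τ '' D j))

/-- The union `D` of the holes, as a subset of the torus. -/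
def holeUnion (τ : ℂ) {M : ℕ} (D : Fin M → Set ℂ) : Set (FlatTorus τ) :=
  ⋃ j, toTorus τ '' D j

/-- The finitely-connected torus `Ω`, the complement of the closure of the union of the holes. -/
def puncturedTorus (τ : ℂ) {M : ℕ} (D : Fin M → Set ℂ) : Set (FlatTorus τ) :=
  (closure (holeUnion τ D))ᶜ

/-- The double-layer kernel `∂_{ν_ξ} G(z - ξ)`: the derivative of `ξ ↦ G(z - ξ)` in the direction
`ν ξ`. -/
def doubleLayerKernel (τ : ℂ) (ν : ℂ → ℂ) (z ξ : ℂ) : ℝ :=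
  fderiv ℝ (fun w : ℂ => greenFunction τ (z - w)) ξ (ν ξ)

/-- `∫_Γ ∂_{ν_ξ} G(z - ξ) |dξ|` converges absolutely and equals `c`; the arc length `|dξ|` is the
one-dimensional Hausdorff measure. -/
def HasDoubleLayerIntegral (τ : ℂ) (ν : ℂ → ℂ) (Γ : Set ℂ) (z : ℂ) (c : ℝ) : Prop :=
  IntegrableOn (doubleLayerKernel τ ν z) Γ (Measure.hausdorffMeasure 1) ∧
  ∫ ξ in Γ, doubleLayerKernel τ ν z ξ ∂(Measure.hausdorffMeasure 1) = c

/-- The part of `Γ` outside the closed disk of radius `ε` about (the class of) `z` in the torus. -/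
def excised (τ : ℂ) (Γ : Set ℂ) (z : ℂ) (ε : ℝ) : Set ℂ :=
  {ξ ∈ Γ | ε < dist (toTorus τ z) (toTorus τ ξ)}

/-- The principal value of `∫_Γ ∂_{ν_ξ} G(z - ξ) |dξ|` exists and equals `c`. -/
def HasPVDoubleLayerIntegral (τ : ℂ) (ν : ℂ → ℂ) (Γ : Set ℂ) (z : ℂ) (c : ℝ) : Prop :=
  (∀ ε > 0, IntegrableOn (doubleLayerKernel τ ν z) (excised τ Γ z ε)
    (Measure.hausdorffMeasure 1)) ∧
  Tendsto (fun ε : ℝ => ∫ ξ in excised τ Γ z ε, doubleLayerKernel τ ν z ξ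
    ∂(Measure.hausdorffMeasure 1)) (𝓝[>] 0) (𝓝 c)

end

open MeasureTheory Topology Filter

/-! Write `ϑ₁(w) = w h(w)` with `h = thetaQuotient τ`, which has no zero at the origin or off the
lattice. Then `G(z - ξ)` is `-(1/2π) log|ξ - z|` plus a part regular near `ξ = z`, and
differentiating along `ν` splits the kernel into the planar double layer kernel and the normal
component of `regularField` (`doubleLayerKernel_eq`). In the regular part `log|h|` is harmonic and
only `(Im w)²/(2b)` has a Laplacian, namely `1/b` (`divergence_regularField`). As `ν` points
inwards, the divergence theorem turns this into `-|D_j|/b`.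

The planar part yields the fraction of a full angle under which the hole is seen from `z`: 1 inside,
1/2 on the boundary, 0 outside (`integral_planarDoubleLayer`). All three cases come from one
regularization, `|ξ - z|²` replaced by `|ξ - z|² + ε²`. The field becomes smooth and its divergence
is minus an approximate identity, whose mass on the hole tends to the bubble mass of the blow-up of
the hole at `z`: the plane, a half-plane or nothing. The boundary integrals converge by domination,
since `|(ξ - z) · ν| ≤ K |ξ - z|²` on a `C²` boundary. Hence the integral converges absolutely even
for `z` on the boundary, and the principal value follows from it (`HasDoubleLayerIntegral.hasPV`).

Two supports are built by hand. The zeros of `ϑ₁` come from the Jacobi triple product up to a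
constant (`exists_shiftedTheta_eq`). The divergence theorem with Hausdorff arc length
(`integral_frontier_eq_neg_integral_divergence`) is localized to graph charts by a partition of
unity. On the torus, injectivity on `closure (D j)` ensures that at most one translate of `z` meets
it; disjoint closures let at most one hole contribute an angle. -/

noncomputable section

/-! ### Zeros of the theta function and periodicity of the Green's function -/

section ThetaProduct

open Complex Real

/-- The product `∏_{n ≥ 0} (1 - q ^ n u)`. -/
def qProduct (q u : ℂ) : ℂ := ∏' n : ℕ, (1 - q ^ n * u)

variable {q : ℂ}

lemma summable_norm_qProduct (hq : ‖q‖ < 1) (u : ℂ) : Summable fun n : ℕ => ‖-(q ^ n * u)‖ := by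
  simp only [norm_neg, norm_mul, norm_pow]
  exact (summable_geometric_of_lt_one (norm_nonneg _) hq).mul_right _

lemma multipliable_qProduct (hq : ‖q‖ < 1) (u : ℂ) :
    Multipliable fun n : ℕ => 1 - q ^ n * u := by
  have := multipliable_one_add_of_summable (summable_norm_qProduct hq u)
  simpa [sub_eq_add_neg] using this

lemma qProduct_eq_mul (hq : ‖q‖ < 1) (u : ℂ) : qProduct q u = (1 - u) * qProduct q (q * u) := by
  have h : Multipliable fun n : ℕ => 1 - q ^ (n + 1) * u := by
    simpa [pow_succ, mul_assoc] using multipliable_qProduct hq (q * u)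
  have := tprod_eq_zero_mul' (f := fun n : ℕ => 1 - q ^ n * u) h
  rw [qProduct, this]
  simp [qProduct, pow_succ, mul_assoc]

lemma qProduct_ne_zero (hq : ‖q‖ < 1) {u : ℂ} (h : ∀ n : ℕ, q ^ n * u ≠ 1) :
    qProduct q u ≠ 0 := by
  have := tprod_one_add_ne_zero_of_summable (f := fun n : ℕ => -(q ^ n * u))
    (fun i => by simpa [← sub_eq_add_neg, sub_eq_zero] using (h i).symm)
    (summable_norm_qProduct hq u)
  simpa [qProduct, sub_eq_add_neg] using this

lemma differentiable_qProduct (hq : ‖q‖ < 1) : Differentiable ℂ (qProduct q) := by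
  have key : HasProdLocallyUniformlyOn (fun (n : ℕ) u => 1 + -(q ^ n * u)) (fun u => ∏' n : ℕ, (1 + -(q ^ n * u)))
      Set.univ := by
    apply hasProdLocallyUniformlyOn_of_forall_compact isOpen_univ
    intro K _ hcK
    obtain ⟨C, hC⟩ := hcK.isBounded.exists_norm_le
    refine ((summable_geometric_of_lt_one (norm_nonneg _) hq).mul_right C).hasProdUniformlyOn_nat_one_add
      hcK (.of_forall fun n x hx => ?_) (fun _ => by fun_prop)
    simp only [norm_neg, norm_mul, norm_pow]
    exact mul_le_mul_of_nonneg_left (hC x hx) (by positivity)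
  have := key.differentiableOn (.of_forall fun _ => by
    simpa [Finset.prod_fn] using DifferentiableOn.finsetProd (fun _ _ => by fun_prop)) isOpen_univ
  rw [differentiableOn_univ] at this
  have e : qProduct q = fun u => ∏' n : ℕ, (1 + -(q ^ n * u)) := by
    ext u; simp [qProduct, sub_eq_add_neg]
  rwa [e]

/-- Integrals over a period of an entire `1`-periodic function do not depend on the line. -/
lemma intervalIntegral_periodic_shift {f : ℂ → ℂ} (hf : Differentiable ℂ f)
    (h1 : ∀ z, f (z + 1) = f z) (τ : ℂ) :
    ∫ x in (0 : ℝ)..1, f (x + τ) = ∫ x in (0 : ℝ)..1, f x := by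
  have hr := integral_boundary_rect_eq_zero_of_differentiableOn f 0 (1 + τ.im * I)
    hf.differentiableOn
  have hv : ∀ y : ℝ, f (1 + y * I) = f (y * I) := fun y => by rw [add_comm, h1]
  simp [hv] at hr
  have hp : Function.Periodic (fun x : ℝ => f (x + τ.im * I)) 1 := fun x => by
    simp only [ofReal_add, ofReal_one]; rw [add_right_comm, h1]
  have h2 := hp.intervalIntegral_add_eq τ.re 0
  rw [zero_add] at h2
  rw [sub_eq_zero] at hr
  rw [hr, ← h2]
  have := intervalIntegral.integral_comp_add_right (a := 0) (b := 1)
    (fun x : ℝ => f (x + τ.im * I)) τ.re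
  rw [zero_add, add_comm] at this
  rw [← this]
  refine intervalIntegral.integral_congr fun x _ => ?_
  simp only [ofReal_add]
  rw [add_assoc, re_add_im]

/-- The quasi-periodicity of `z ↦ jacobiTheta₂ (z + (1 + τ) / 2) τ`. -/
structure IsThetaLike (τ : ℂ) (f : ℂ → ℂ) : Prop where
  differentiable : Differentiable ℂ f
  add_one : ∀ z, f (z + 1) = f z
  add_tau : ∀ z, f (z + τ) = -cexp (-(2 * π * I * (z + τ))) * f z

/-- Moving the line of integration from `ℝ` to `ℝ + τ` changes nothing, while quasi-periodicity
turns the shifted integrand into the next Fourier mode. The factor never vanishes, so the mean over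
a period determines all Fourier coefficients. -/
lemma IsThetaLike.coeff_succ {τ : ℂ} {f : ℂ → ℂ} (hf : IsThetaLike τ f) (n : ℤ) :
    ∫ x in (0 : ℝ)..1, cexp (-(2 * π * I * n * x)) * f x =
      -cexp (-(2 * π * I * (n + 1) * τ)) *
        ∫ x in (0 : ℝ)..1, cexp (-(2 * π * I * ((n + 1 : ℤ) : ℂ) * x)) * f x := by
  have h := intervalIntegral_periodic_shift (f := fun z => cexp (-(2 * π * I * n * z)) * f z)
    (by have := hf.differentiable; fun_prop) (fun z => by
      rw [hf.add_one]
      congr 1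
      rw [show -(2 * π * I * n * (z + 1)) = -(2 * π * I * n * z) + ((-n : ℤ) : ℂ) * (2 * π * I) by
        push_cast; ring]
      rw [Complex.exp_add, exp_int_mul_two_pi_mul_I, mul_one]) τ
  rw [← h, ← intervalIntegral.integral_const_mul]
  refine intervalIntegral.integral_congr fun x _ => ?_
  simp only [hf.add_tau]
  rw [← mul_assoc, ← mul_assoc, mul_neg, neg_mul, neg_mul, neg_mul,
    ← Complex.exp_add, ← Complex.exp_add]
  congr 3
  push_cast
  ring

/-- The recursion, run in both directions from the zeroth coefficient, kills the Fourier series on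
the real line; the identity theorem does the rest. -/
lemma IsThetaLike.eq_zero {τ : ℂ} {f : ℂ → ℂ} (hf : IsThetaLike τ f)
    (h0 : ∫ x in (0 : ℝ)..1, f x = 0) : f = 0 := by
  have hc : ∀ n : ℤ, ∫ x in (0 : ℝ)..1, cexp (-(2 * π * I * n * x)) * f x = 0 := by
    intro n
    induction n using Int.induction_on with
    | zero => simpa using h0
    | succ n ih =>
      have := hf.coeff_succ n
      rw [ih] at this
      simpa using this.symm
    | pred n ih =>
      have := hf.coeff_succ (-n - 1)
      rw [this]
      simp only [sub_add_cancel]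
      rw [ih, mul_zero]
  have hp : Function.Periodic (fun x : ℝ => f x) 1 := fun x => by
    simpa using hf.add_one x
  have : Fact (0 < (1 : ℝ)) := ⟨one_pos⟩
  let F : C(AddCircle (1 : ℝ), ℂ) := ⟨hp.lift, by
    have : Continuous (fun x : ℝ => f x) := by
      have := hf.differentiable.continuous; fun_prop
    exact continuous_quot_lift _ this⟩
  have hF : ∀ x : ℝ, F x = f x := fun x => rfl
  have hco : fourierCoeff F = 0 := by
    ext n
    rw [fourierCoeff_eq_intervalIntegral F n 0]
    have := hc n
    simp only [zero_add, div_one, one_smul, Pi.zero_apply]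
    rw [← this]
    refine intervalIntegral.integral_congr fun x _ => ?_
    simp only [hF, smul_eq_mul, fourier_coe_apply]
    congr 2
    push_cast
    ring
  have hz : ∀ x : ℝ, f x = 0 := fun x => by
    have := has_pointwise_sum_fourier_series_of_summable (f := F)
      (by rw [hco]; exact summable_zero) x
    rw [hco] at this
    simp only [Pi.zero_apply, zero_smul] at this
    rw [← hF]
    exact this.unique hasSum_zero
  have ha : AnalyticOnNhd ℂ f Set.univ := fun z _ => hf.differentiable.analyticAt z
  refine ha.eq_of_frequently_eq (z₀ := 0) (fun z _ => analyticAt_const) ?_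
  have ht : Tendsto (fun x : ℝ => (x : ℂ)) (𝓝[≠] 0) (𝓝[≠] 0) := by
    refine tendsto_nhdsWithin_iff.2 ⟨?_, ?_⟩
    · exact (continuous_ofReal.tendsto' 0 0 (by simp)).mono_left nhdsWithin_le_nhds
    · filter_upwards [self_mem_nhdsWithin] with x hx
      simpa using hx
  exact ht.frequently (Frequently.of_forall hz)

/-- The conditions are linear, so the combination of `f` and `g` with mean zero is again theta-like
and vanishes: the space has dimension at most one. -/
lemma IsThetaLike.exists_eq_const_mul {τ : ℂ} {f g : ℂ → ℂ} (hf : IsThetaLike τ f)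
    (hg : IsThetaLike τ g) (hf0 : f ≠ 0) (hg0 : g ≠ 0) :
    ∃ c : ℂ, c ≠ 0 ∧ ∀ z, f z = c * g z := by
  have hf1 : ∫ x in (0 : ℝ)..1, f x ≠ 0 := fun h => hf0 (hf.eq_zero h)
  have hg1 : ∫ x in (0 : ℝ)..1, g x ≠ 0 := fun h => hg0 (hg.eq_zero h)
  set a := ∫ x in (0 : ℝ)..1, f x
  set b := ∫ x in (0 : ℝ)..1, g x
  have hcf := hf.differentiable.continuous
  have hcg := hg.differentiable.continuous
  have h : IsThetaLike τ (fun z => b * f z - a * g z) :=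
    ⟨by have := hf.differentiable; have := hg.differentiable; fun_prop,
      fun z => by rw [hf.add_one, hg.add_one],
      fun z => by rw [hf.add_tau, hg.add_tau]; ring⟩
  have h0 := h.eq_zero (by
    rw [intervalIntegral.integral_sub, intervalIntegral.integral_const_mul,
      intervalIntegral.integral_const_mul]
    · simp only [a, b]; ring
    · exact Continuous.intervalIntegrable (by fun_prop) _ _
    · exact Continuous.intervalIntegrable (by fun_prop) _ _)
  refine ⟨a / b, div_ne_zero hf1 hg1, fun z => ?_⟩
  have := congrFun h0 z
  simp only [Pi.zero_apply, sub_eq_zero] at this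
  field_simp
  linear_combination this

/-- The product side of the Jacobi triple product. -/
def thetaProduct (τ z : ℂ) : ℂ :=
  qProduct (cexp (2 * π * I * τ)) (cexp (2 * π * I * τ) * cexp (2 * π * I * z)) *
    qProduct (cexp (2 * π * I * τ)) (cexp (-(2 * π * I * z)))

lemma norm_exp_two_pi_I_mul_lt_one {τ : ℂ} (hτ : 0 < τ.im) : ‖cexp (2 * π * I * τ)‖ < 1 := by
  rw [Complex.norm_exp]
  have : (2 * π * I * τ).re = -(2 * π * τ.im) := by simp
  rw [this, Real.exp_lt_one_iff]
  have := Real.pi_pos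
  nlinarith [mul_pos this hτ]

lemma exp_two_pi_I_mul_add_one (z : ℂ) : cexp (2 * π * I * (z + 1)) = cexp (2 * π * I * z) := by
  rw [mul_add, mul_one, Complex.exp_add, exp_two_pi_mul_I, mul_one]

lemma exp_neg_two_pi_I_mul_add_one (z : ℂ) :
    cexp (-(2 * π * I * (z + 1))) = cexp (-(2 * π * I * z)) := by
  rw [Complex.exp_neg, exp_two_pi_I_mul_add_one, ← Complex.exp_neg]

/-- Translation by `τ` multiplies `exp (2πiz)` by `q`: one product loses its first factor, the other
gains one, and the quotient of the two factors is the multiplier. -/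
lemma isThetaLike_thetaProduct {τ : ℂ} (hτ : 0 < τ.im) : IsThetaLike τ (thetaProduct τ) := by
  have hq := norm_exp_two_pi_I_mul_lt_one hτ
  refine ⟨?_, fun z => ?_, fun z => ?_⟩
  · have := differentiable_qProduct hq
    unfold thetaProduct
    fun_prop
  · rw [thetaProduct, exp_two_pi_I_mul_add_one, exp_neg_two_pi_I_mul_add_one, thetaProduct]
  · have h1 := qProduct_eq_mul hq (cexp (2 * π * I * τ) * cexp (2 * π * I * z))
    have h2 := qProduct_eq_mul hq (cexp (-(2 * π * I * (z + τ))))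
    have e1 : cexp (2 * π * I * (z + τ)) = cexp (2 * π * I * τ) * cexp (2 * π * I * z) := by
      rw [← Complex.exp_add]; ring_nf
    have e2 : cexp (2 * π * I * τ) * cexp (-(2 * π * I * (z + τ))) = cexp (-(2 * π * I * z)) := by
      rw [← Complex.exp_add]; ring_nf
    have e3 : cexp (-(2 * π * I * (z + τ))) * (cexp (2 * π * I * τ) * cexp (2 * π * I * z)) = 1 := by
      rw [← Complex.exp_add, ← Complex.exp_add, ← Complex.exp_zero]; ring_nf
    rw [e2] at h2
    rw [thetaProduct, thetaProduct, h1, h2, e1]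
    linear_combination (qProduct (cexp (2 * π * I * τ)) (cexp (-(2 * π * I * z)))) * (qProduct (cexp (2 * π * I * τ))
      (cexp (2 * π * I * τ) * (cexp (2 * π * I * τ) * cexp (2 * π * I * z)))) * -e3

/-- A convergent product vanishes only through one of its factors, and a vanishing factor equates
`exp (2πiz)` with an integral power of `q`, which puts `z` in the lattice. -/
lemma thetaProduct_ne_zero {τ : ℂ} (hτ : 0 < τ.im) {z : ℂ} (hz : ∀ m n : ℤ, z ≠ m + n * τ) :
    thetaProduct τ z ≠ 0 := by
  have hq := norm_exp_two_pi_I_mul_lt_one hτ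
  have hpi : (2 * π * I : ℂ) ≠ 0 := two_pi_I_ne_zero
  refine mul_ne_zero (qProduct_ne_zero hq fun n h => ?_) (qProduct_ne_zero hq fun n h => ?_)
  · rw [← Complex.exp_nat_mul, ← Complex.exp_add, ← Complex.exp_add, Complex.exp_eq_one_iff] at h
    obtain ⟨k, hk⟩ := h
    refine hz k (-(n + 1 : ℕ)) ?_
    have : (2 * π * I) * (z - (k - (n + 1) * τ)) = 0 := by linear_combination hk
    have := (mul_eq_zero.1 this).resolve_left hpi
    push_cast
    linear_combination this
  · rw [← Complex.exp_nat_mul, ← Complex.exp_add, Complex.exp_eq_one_iff] at h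
    obtain ⟨k, hk⟩ := h
    refine hz (-k) n ?_
    have : (2 * π * I) * (z - (-k + n * τ)) = 0 := by linear_combination -hk
    have := (mul_eq_zero.1 this).resolve_left hpi
    push_cast
    linear_combination this

/-- The theta function `jacobiTheta₂` with its zeros moved to the lattice. -/
def shiftedTheta (τ z : ℂ) : ℂ := jacobiTheta₂ (z + (1 + τ) / 2) τ

lemma isThetaLike_shiftedTheta {τ : ℂ} (hτ : 0 < τ.im) : IsThetaLike τ (shiftedTheta τ) := by
  refine ⟨fun z => ?_, fun z => ?_, fun z => ?_⟩
  · exact (differentiableAt_jacobiTheta₂_fst (z + (1 + τ) / 2) hτ).comp z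
      (differentiableAt_id.add_const _)
  · rw [shiftedTheta, add_right_comm, jacobiTheta₂_add_left, shiftedTheta]
  · rw [shiftedTheta, add_right_comm, jacobiTheta₂_add_left', shiftedTheta]
    rw [show -π * I * (τ + 2 * (z + (1 + τ) / 2)) = π * I + ((-1 : ℤ) : ℂ) * (2 * π * I) +
      -(2 * π * I * (z + τ)) by push_cast; ring, Complex.exp_add, Complex.exp_add, exp_pi_mul_I,
      exp_int_mul_two_pi_mul_I]
    ring

/-- Termwise, from `(n + 1/2)² = n² + n + 1/4` and `(-1)^n = exp (πin)`. -/
lemma jacobiThetaOne_eq (τ z : ℂ) :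
    jacobiThetaOne τ z = -I * cexp (π * I * (z + τ / 4)) * shiftedTheta τ z := by
  rw [jacobiThetaOne, shiftedTheta, jacobiTheta₂, ← tsum_mul_left, ← tsum_mul_left]
  refine tsum_congr fun n => ?_
  have : (-1 : ℂ) ^ n = cexp (π * I * n) := by
    rw [← exp_pi_mul_I, ← Complex.exp_int_mul, mul_comm]
  rw [jacobiTheta₂_term, this, ← Complex.exp_add, ← Complex.exp_add, mul_assoc (-I),
    ← Complex.exp_add]
  congr 2
  ring

lemma integral_exp_two_pi_I_int (n : ℤ) :
    ∫ x in (0 : ℝ)..1, cexp (2 * π * I * n * x) = if n = 0 then 1 else 0 := by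
  split_ifs with h
  · simp [h]
  · have hc : (2 * π * I * n : ℂ) ≠ 0 := mul_ne_zero two_pi_I_ne_zero (by exact_mod_cast h)
    rw [integral_exp_mul_complex hc]
    have : (2 * π * I * n : ℂ) = n * (2 * π * I) := by ring
    simp [this, exp_int_mul_two_pi_mul_I]

/-- Only the term `n = 0` survives integration over a period, so the mean is 1. -/
lemma shiftedTheta_ne_zero {τ : ℂ} (hτ : 0 < τ.im) : shiftedTheta τ ≠ 0 := by
  intro h0
  have hs : HasSum (fun n : ℤ => ∫ x in (0 : ℝ)..1, jacobiTheta₂_term n (x + (1 + τ) / 2) τ)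
      (∫ x in (0 : ℝ)..1, shiftedTheta τ x) := by
    -- The standard bound on the terms depends only on the imaginary part of the argument, which is
    -- `τ.im / 2` for every real `x`.
    refine intervalIntegral.hasSum_integral_of_dominated_convergence
      (fun n _ => rexp (-π * (τ.im * n ^ 2 - 2 * (|τ.im / 2|) * |n|))) (fun n => ?_) (fun n => ?_)
      ?_ ?_ ?_
    · unfold jacobiTheta₂_term
      exact Continuous.aestronglyMeasurable (by fun_prop)
    · refine .of_forall fun x _ => norm_jacobiTheta₂_term_le hτ ?_ le_rfl n
      simp
    · refine .of_forall fun x _ => ?_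
      simpa using summable_pow_mul_jacobiTheta₂_term_bound (|τ.im / 2|) hτ 0
    · exact intervalIntegrable_const
    · exact .of_forall fun x _ => hasSum_jacobiTheta₂_term _ hτ
  have hi : ∀ n : ℤ, ∫ x in (0 : ℝ)..1, jacobiTheta₂_term n (x + (1 + τ) / 2) τ =
      if n = 0 then 1 else 0 := by
    intro n
    have : ∀ x : ℝ, jacobiTheta₂_term n (x + (1 + τ) / 2) τ =
        cexp (2 * π * I * n * ((1 + τ) / 2) + π * I * n ^ 2 * τ) * cexp (2 * π * I * n * x) := by
      intro x
      rw [jacobiTheta₂_term, ← Complex.exp_add]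
      ring_nf
    simp_rw [this]
    rw [intervalIntegral.integral_const_mul, integral_exp_two_pi_I_int]
    split_ifs with h
    · simp [h]
    · simp
  simp_rw [hi] at hs
  have := hs.unique (hasSum_ite_eq (0 : ℤ) (1 : ℂ))
  simp [h0] at this

/-- The Jacobi triple product up to its constant; locating zeros needs only that the constant is
nonzero. -/
lemma exists_shiftedTheta_eq {τ : ℂ} (hτ : 0 < τ.im) :
    ∃ c : ℂ, c ≠ 0 ∧ ∀ z, shiftedTheta τ z = c * thetaProduct τ z := by
  refine (isThetaLike_shiftedTheta hτ).exists_eq_const_mul (isThetaLike_thetaProduct hτ)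
    (shiftedTheta_ne_zero hτ) fun h => ?_
  -- The point 1/2 is not in the lattice: its imaginary part forces `n = 0`, and then `2m = 1`.
  refine thetaProduct_ne_zero hτ (z := 1 / 2) (fun m n hmn => ?_) (congrFun h _)
  have him := congrArg Complex.im hmn
  have hre := congrArg Complex.re hmn
  simp at him hre
  rcases him with h | h
  · subst h
    simp at hre
    have : (2 * m : ℝ) = 1 := by linarith
    have : (2 * m : ℤ) = 1 := by exact_mod_cast this
    omega
  · exact hτ.ne' h

lemma differentiable_jacobiThetaOne {τ : ℂ} (hτ : 0 < τ.im) :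
    Differentiable ℂ (jacobiThetaOne τ) := by
  have := (isThetaLike_shiftedTheta hτ).differentiable
  have h : jacobiThetaOne τ = fun z => -I * cexp (π * I * (z + τ / 4)) * shiftedTheta τ z :=
    funext (jacobiThetaOne_eq τ)
  rw [h]
  fun_prop

lemma jacobiThetaOne_ne_zero {τ : ℂ} (hτ : 0 < τ.im) {z : ℂ}
    (hz : ∀ m n : ℤ, z ≠ m + n * τ) : jacobiThetaOne τ z ≠ 0 := by
  obtain ⟨c, hc, h⟩ := exists_shiftedTheta_eq hτ
  rw [jacobiThetaOne_eq, h]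
  exact mul_ne_zero (mul_ne_zero (neg_ne_zero.2 I_ne_zero) (Complex.exp_ne_zero _))
    (mul_ne_zero hc (thetaProduct_ne_zero hτ hz))

/-- The theta function divided by its simple zero at the origin. -/
def thetaQuotient (τ : ℂ) : ℂ → ℂ := dslope (jacobiThetaOne τ) 0

/-- Splitting off the first factor of the second product, the only factor that vanishes at the
origin, shows that the zero there is simple. -/
lemma exists_jacobiThetaOne_eq_mul {τ : ℂ} (hτ : 0 < τ.im) :
    ∃ H : ℂ → ℂ, Differentiable ℂ H ∧ H 0 ≠ 0 ∧
      ∀ z, jacobiThetaOne τ z = (1 - cexp (-(2 * π * I * z))) * H z := by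
  have hq := norm_exp_two_pi_I_mul_lt_one hτ
  obtain ⟨c, hc, h⟩ := exists_shiftedTheta_eq hτ
  refine ⟨fun z => -I * cexp (π * I * (z + τ / 4)) * (c *
    (qProduct (cexp (2 * π * I * τ)) (cexp (2 * π * I * τ) * cexp (2 * π * I * z)) *
    qProduct (cexp (2 * π * I * τ)) (cexp (2 * π * I * τ) * cexp (-(2 * π * I * z))))),
    ?_, ?_, fun z => ?_⟩
  · have := differentiable_qProduct hq
    fun_prop
  · have h0 : qProduct (cexp (2 * π * I * τ)) (cexp (2 * π * I * τ)) ≠ 0 := by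
      refine qProduct_ne_zero hq fun n hn => ?_
      have := congrArg norm hn
      rw [← pow_succ, norm_pow, norm_one] at this
      exact (pow_lt_one₀ (norm_nonneg _) hq n.succ_ne_zero).ne this
    simp [hc, h0]
  · rw [jacobiThetaOne_eq, h, thetaProduct, qProduct_eq_mul hq (cexp (-(2 * π * I * z)))]
    ring

lemma differentiable_thetaQuotient {τ : ℂ} (hτ : 0 < τ.im) : Differentiable ℂ (thetaQuotient τ) := by
  rw [← differentiableOn_univ, thetaQuotient, Complex.differentiableOn_dslope Filter.univ_mem]
  exact (differentiable_jacobiThetaOne hτ).differentiableOn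

lemma jacobiThetaOne_eq_mul_thetaQuotient {τ : ℂ} (hτ : 0 < τ.im) (z : ℂ) :
    jacobiThetaOne τ z = z * thetaQuotient τ z := by
  obtain ⟨H, -, -, h⟩ := exists_jacobiThetaOne_eq_mul hτ
  have h0 : jacobiThetaOne τ 0 = 0 := by simp [h]
  have := sub_smul_dslope (jacobiThetaOne τ) 0 z
  simpa [h0, thetaQuotient] using this.symm

lemma thetaQuotient_ne_zero {τ : ℂ} (hτ : 0 < τ.im) {z : ℂ}
    (hz : z = 0 ∨ ∀ m n : ℤ, z ≠ m + n * τ) : thetaQuotient τ z ≠ 0 := by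
  rcases hz with rfl | hz
  · obtain ⟨H, hd, hH, h⟩ := exists_jacobiThetaOne_eq_mul hτ
    rw [thetaQuotient, dslope_same]
    have h1 : HasDerivAt (fun z : ℂ => 1 - cexp (-(2 * π * I * z))) (2 * π * I) 0 := by
      have := (((hasDerivAt_id (0 : ℂ)).const_mul (2 * π * I : ℂ)).neg.cexp).const_sub 1
      simpa using this
    have h2 := h1.mul (hd 0).hasDerivAt
    have h3 : jacobiThetaOne τ = (fun z : ℂ => 1 - cexp (-(2 * π * I * z))) * H := funext h
    rw [h3, h2.deriv]
    simpa using hH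
  · have := jacobiThetaOne_ne_zero hτ hz
    rw [jacobiThetaOne_eq_mul_thetaQuotient hτ] at this
    exact right_ne_zero_of_mul this

lemma greenFunction_add_one {τ : ℂ} (hτ : 0 < τ.im) (z : ℂ) :
    greenFunction τ (z + 1) = greenFunction τ z := by
  have : ‖jacobiThetaOne τ (z + 1)‖ = ‖jacobiThetaOne τ z‖ := by
    rw [jacobiThetaOne_eq, jacobiThetaOne_eq, (isThetaLike_shiftedTheta hτ).add_one]
    simp [Complex.norm_exp]
  simp [greenFunction, this]

/-- The logarithm of the growth factor of `|ϑ₁|` contributes `-Im z - b/2`, exactly compensated by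
the increment of `(Im z)²/(2b)`. Lattice points are excluded because `Real.log 0 = 0` would break
the product rule for the logarithm. -/
lemma greenFunction_add_tau {τ : ℂ} (hτ : 0 < τ.im) {z : ℂ} (hz : ∀ m n : ℤ, z ≠ m + n * τ) :
    greenFunction τ (z + τ) = greenFunction τ z := by
  have : ‖jacobiThetaOne τ (z + τ)‖ = rexp (2 * π * z.im + π * τ.im) * ‖jacobiThetaOne τ z‖ := by
    rw [jacobiThetaOne_eq, jacobiThetaOne_eq, (isThetaLike_shiftedTheta hτ).add_tau]
    simp only [norm_mul, norm_neg, norm_I, one_mul, Complex.norm_exp, ← mul_assoc, ← Real.exp_add]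
    congr 2
    simp
    ring
  rw [greenFunction, this, Real.log_mul (Real.exp_ne_zero _)
    (norm_ne_zero_iff.2 (jacobiThetaOne_ne_zero hτ hz)), Real.log_exp, greenFunction]
  have := Real.pi_pos
  simp only [add_im]
  field_simp
  ring

end ThetaProduct

/-! ### Boundary charts -/

/-- Near its boundary point `p`, and in the coordinates `w = (ξ - p) / n`, the set `D` is the part
`g (im w) < re w` to the right of the graph of `g`. -/
structure IsBoundaryChart (D : Set ℂ) (p n : ℂ) (g : ℝ → ℝ) (r : ℝ) : Prop where
  norm_eq_one : ‖n‖ = 1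
  pos : 0 < r
  contDiff : ContDiff ℝ 2 g
  map_zero : g 0 = 0
  deriv_zero : deriv g 0 = 0
  mem_iff : ∀ w : ℂ, |w.re| < r → |w.im| < r → (p + n * w ∈ D ↔ g w.im < w.re)

/-- A bump function extends the implicit function, which is `C²` only near 0, to a globally defined
profile, so that later integrals run over a full graph. -/
lemma exists_contDiff_eqOn_ball {ψ : ℝ → ℝ} (h : ContDiffAt ℝ 2 ψ 0) :
    ∃ g : ℝ → ℝ, ∃ r > 0, ContDiff ℝ 2 g ∧ ∀ t, |t| < r → g t = ψ t := by
  obtain ⟨δ, hδ, hb⟩ := Metric.eventually_nhds_iff_ball.1 (h.eventually (by simp))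
  let χ : ContDiffBump (0 : ℝ) := ⟨δ / 4, δ / 2, by positivity, by linarith⟩
  refine ⟨fun t => χ t * ψ t, δ / 4, by positivity, ?_, fun t ht => ?_⟩
  · rw [contDiff_iff_contDiffAt]
    intro t
    by_cases ht : t ∈ Metric.ball (0 : ℝ) δ
    · exact χ.contDiffAt.mul (hb t ht)
    · refine (contDiffAt_const (c := (0 : ℝ))).congr_of_eventuallyEq ?_
      have : t ∉ tsupport χ := by
        rw [χ.tsupport_eq]
        simp only [Metric.mem_ball, dist_zero_right, not_lt, Metric.mem_closedBall, not_le] at ht ⊢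
        have : χ.rOut = δ / 2 := rfl
        linarith
      filter_upwards [notMem_tsupport_iff_eventuallyEq.1 this] with s hs
      simp [hs]
  · simp only [χ.one_of_mem_closedBall (show t ∈ Metric.closedBall 0 χ.rIn by simpa using ht.le),
      one_mul]

lemma clm_complex_apply (L : ℂ →L[ℝ] ℝ) (v : ℂ) : L v = v.re * L 1 + v.im * L Complex.I := by
  rw [← smul_eq_mul, ← smul_eq_mul, ← map_smul, ← map_smul, ← map_add]
  simp [Complex.re_add_im]

/-- `n` is the direction of the gradient of `L`; in the frame `n`, `i n` only the first coordinate
matters. -/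
lemma exists_unit_clm_apply_mul {L : ℂ →L[ℝ] ℝ} (hL : L ≠ 0) :
    ∃ n : ℂ, ‖n‖ = 1 ∧ ∃ c > 0, ∀ w : ℂ, L (n * w) = c * w.re := by
  set m : ℂ := ⟨L 1, L Complex.I⟩
  have hm : m ≠ 0 := fun h => hL (by
    ext v
    have h1 := congrArg Complex.re h
    have h2 := congrArg Complex.im h
    simp only [m, Complex.zero_re, Complex.zero_im] at h1 h2
    rw [clm_complex_apply, h1, h2]
    simp)
  have hm' : 0 < ‖m‖ := norm_pos_iff.2 hm
  refine ⟨m / ‖m‖, by simp [hm'.ne'], ‖m‖, hm', fun w => ?_⟩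
  have hsq : ‖m‖ ^ 2 = L 1 ^ 2 + L Complex.I ^ 2 := by
    rw [Complex.sq_norm, Complex.normSq_apply]; ring
  rw [clm_complex_apply, div_mul_eq_mul_div, Complex.div_ofReal_re, Complex.div_ofReal_im]
  have h1 : m.re = L 1 := rfl
  have h2 : m.im = L Complex.I := rfl
  rw [Complex.mul_re, Complex.mul_im, h1, h2]
  field_simp
  rw [hsq]
  ring

/-- In a frame aligned with the gradient of `ρ` the implicit function theorem writes `ρ = 0` as a
graph with zero slope at `p`. Monotonicity of `ρ` in the normal direction then identifies the side
on which `ρ` is positive. -/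
theorem HasC2Boundary.exists_chart {D : Set ℂ} (hD : HasC2Boundary D) (ho : IsOpen D) {p : ℂ}
    (hp : p ∈ frontier D) : ∃ n g r, IsBoundaryChart D p n g r := by
  obtain ⟨U, hU, hpU, ρ, hρ, hne, hDU⟩ := hD p hp
  have hmem : ∀ ξ ∈ U, (ξ ∈ D ↔ 0 < ρ ξ) := fun ξ hξ => by
    have := Set.ext_iff.1 hDU ξ
    simpa [hξ] using this
  have hρp : ContDiffAt ℝ 2 ρ p := hρ.contDiffAt (hU.mem_nhds hpU)
  -- `p` is a limit of points of `D` but not in the open set `D`, so neither sign of `ρ p` is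
  -- possible.
  have hp0 : ρ p = 0 := by
    rw [ho.frontier_eq] at hp
    refine le_antisymm (not_lt.1 fun h => hp.2 ((hmem p hpU).2 h)) (not_lt.1 fun h => ?_)
    have h1 : ∀ᶠ ξ in 𝓝 p, ρ ξ < 0 := hρp.continuousAt.eventually_lt_const h
    obtain ⟨ξ, h2, h3, h4⟩ := ((mem_closure_iff_frequently.1 hp.1).and_eventually
      (h1.and (hU.mem_nhds hpU))).exists
    exact ((hmem ξ h4).1 h2).not_gt h3
  obtain ⟨n, hn, c, hc, hL⟩ := exists_unit_clm_apply_mul (hne p hpU)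
  -- The tangential coordinate is put first and the normal one second, since the implicit function
  -- solves for the second variable.
  let A : ℝ × ℝ →L[ℝ] ℂ := (ContinuousLinearMap.snd ℝ ℝ ℝ).smulRight n +
    (ContinuousLinearMap.fst ℝ ℝ ℝ).smulRight (n * Complex.I)
  have hA : ∀ v : ℝ × ℝ, A v = n * (v.2 + v.1 * Complex.I) := fun v => by
    simp [A]; ring
  let f : ℝ × ℝ → ℝ := fun v => ρ (p + A v)
  have hpA : ∀ᶠ v : ℝ × ℝ in 𝓝 0, p + A v ∈ U :=
    (Continuous.tendsto' (by fun_prop) 0 p (by simp)).eventually (hU.mem_nhds hpU)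
  have hf' : ∀ v, p + A v ∈ U → HasFDerivAt f ((fderiv ℝ ρ (p + A v)).comp A) v := fun v hv => by
    have h1 := ((hρ.contDiffAt (hU.mem_nhds hv)).differentiableAt (by simp)).hasFDerivAt
    exact h1.comp v (A.hasFDerivAt.const_add p)
  have hA0 : p + A (0, 0) = p := by simp [hA]
  have hf : ContDiffAt ℝ 2 f (0, 0) := by
    refine ContDiffAt.comp (g := ρ) (f := fun v => p + A v) _ (by rw [hA0]; exact hρp) ?_
    exact contDiffAt_const.add A.contDiff.contDiffAt
  have hf0 : f (0, 0) = 0 := by simp only [f, hA0, hp0]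
  have hfd : fderiv ℝ f (0, 0) = (fderiv ℝ ρ p).comp A := by
    have := (hf' (0, 0) (by rwa [hA0])).fderiv
    rwa [hA0] at this
  have hLn : fderiv ℝ ρ p n = c := by simpa using hL 1
  have hinr : fderiv ℝ f (0, 0) ∘L .inr ℝ ℝ ℝ = c • ContinuousLinearMap.id ℝ ℝ := by
    ext
    rw [hfd]
    simp [hA, hLn]
  have hinl : fderiv ℝ f (0, 0) ∘L .inl ℝ ℝ ℝ = 0 := by
    ext
    rw [hfd]
    simp [hA, hL]
  have hinv : (fderiv ℝ f (0, 0) ∘L .inr ℝ ℝ ℝ).IsInvertible := by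
    rw [hinr]
    exact ⟨ContinuousLinearEquiv.unitsEquivAut ℝ (Units.mk0 c hc.ne'), by ext; simp⟩
  set ψ := hf.implicitFunction (by simp) hinv
  have hψc : ContDiffAt ℝ 2 ψ 0 := hf.contDiffAt_implicitFunction (by simp) hinv
  have hψ0 : ψ 0 = 0 := ((hf.eventually_apply_eq_iff_implicitFunction (by simp) hinv).self_of_nhds).1
    rfl
  have hψd : deriv ψ 0 = 0 := by
    have := hf.hasStrictFDerivAt_implicitFunction (by simp) hinv
    rw [hinl] at this
    have := this.hasFDerivAt.hasDerivAt.deriv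
    simpa using this
  have hψf : ∀ᶠ t in 𝓝 (0 : ℝ), f (t, ψ t) = 0 := by
    have := hf.eventually_apply_implicitFunction (by simp) hinv
    simpa [hf0] using this
  have hpos : ∀ᶠ v : ℝ × ℝ in 𝓝 0, 0 < fderiv ℝ ρ (p + A v) n := by
    have h1 : ContinuousAt (fun v : ℝ × ℝ => fderiv ℝ ρ (p + A v) n) 0 := by
      have h2 : ContinuousAt (fderiv ℝ ρ) (p + A 0) := by
        rw [map_zero, add_zero]
        exact (hρp.fderiv_right (m := 1) (by norm_num)).continuousAt
      exact (ContinuousAt.comp (f := fun v : ℝ × ℝ => p + A v) h2 (by fun_prop)).clm_apply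
        continuousAt_const
    refine h1.eventually_const_lt ?_
    simpa [hLn] using hc
  obtain ⟨g, r₀, hr₀, hg, hgψ⟩ := exists_contDiff_eqOn_ball hψc
  obtain ⟨δ, hδ, hb⟩ := Metric.eventually_nhds_iff_ball.1 (hpA.and hpos)
  have hball : ∀ t s : ℝ, |t| < δ → |s| < δ → ((t, s) : ℝ × ℝ) ∈ Metric.ball (0 : ℝ × ℝ) δ := by
    intro t s ht hs
    rw [Metric.mem_ball, dist_zero_right, Prod.norm_def]
    exact max_lt ht hs
  have hψb : ∀ᶠ t in 𝓝 (0 : ℝ), |ψ t| < δ := by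
    have : ContinuousAt (fun t => |ψ t|) 0 := hψc.continuousAt.abs
    exact this.eventually_lt_const (by simpa [hψ0] using hδ)
  obtain ⟨r₁, hr₁, hb₁⟩ := Metric.eventually_nhds_iff_ball.1 (hψf.and hψb)
  have hgψ' : g =ᶠ[𝓝 0] ψ := by
    filter_upwards [Metric.ball_mem_nhds (0 : ℝ) hr₀] with t ht
    exact hgψ t (by simpa using ht)
  refine ⟨n, g, min δ (min r₀ r₁), hn, by positivity, hg, ?_, ?_, fun w hre him => ?_⟩
  · rw [hgψ'.self_of_nhds, hψ0]
  · rw [hgψ'.deriv_eq, hψd]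
  · simp only [lt_min_iff] at hre him
    have hw : p + n * w = p + A (w.im, w.re) := by rw [hA, Complex.re_add_im]
    rw [hgψ _ him.2.1, hw, hmem _ (hb _ (hball _ _ him.1 hre.1)).1]
    obtain ⟨hz, hψw⟩ := hb₁ w.im (by simpa using him.2.2)
    -- On the vertical segment `ρ` increases strictly and vanishes at height `ψ`, so its sign tells
    -- the side of the graph.
    have hmono : StrictMonoOn (fun s => f (w.im, s)) (Set.Ioo (-δ) δ) := by
      have hd : ∀ s ∈ Set.Ioo (-δ) δ, HasDerivAt (fun s => f (w.im, s))
          (fderiv ℝ ρ (p + A (w.im, s)) n) s := fun s hs => by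
        have h1 := hf' (w.im, s) (hb _ (hball _ _ him.1 (abs_lt.2 hs))).1
        have h2 : HasDerivAt (fun s : ℝ => ((w.im, s) : ℝ × ℝ)) (0, 1) s :=
          (hasDerivAt_const s w.im).prodMk (hasDerivAt_id s)
        have := h1.comp_hasDerivAt s h2
        simp only [ContinuousLinearMap.comp_apply, hA (0, 1)] at this
        simpa [Function.comp_def] using this
      refine strictMonoOn_of_deriv_pos (convex_Ioo _ _)
        (fun s hs => (hd s hs).continuousAt.continuousWithinAt) fun s hs => ?_
      rw [interior_Ioo] at hs
      rw [(hd s hs).deriv]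
      exact (hb _ (hball _ _ him.1 (abs_lt.2 hs))).2
    have := hmono.lt_iff_lt (abs_lt.1 hψw) (abs_lt.1 hre.1)
    simp only [hz] at this
    exact this

/-! ### Arc length as one-dimensional Hausdorff measure -/

section ArcLength

open scoped ENNReal NNReal

variable {γ γ' : ℝ → ℂ}

/-- On the piece, `γ` is Lipschitz with constant `m + ε` and its inverse with constant `(m - ε)⁻¹`;
one-dimensional Hausdorff measure grows at most by the Lipschitz constant. -/
lemma hausdorffMeasure_image_Ioc_bounds (hinj : Function.Injective γ) {m ε u v : ℝ} (hε : 0 ≤ ε)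
    (hm : ε < m)
    (h : ∀ x ∈ Set.Ioc u v, ∀ y ∈ Set.Ioc u v, abs (‖γ x - γ y‖ - m * |x - y|) ≤ ε * |x - y|) :
    ENNReal.ofReal ((m - ε) * (v - u)) ≤ Measure.hausdorffMeasure 1 (γ '' Set.Ioc u v) ∧
      Measure.hausdorffMeasure 1 (γ '' Set.Ioc u v) ≤ ENNReal.ofReal ((m + ε) * (v - u)) := by
  have hvol : Measure.hausdorffMeasure 1 (Set.Ioc u v) = ENNReal.ofReal (v - u) := by
    rw [hausdorffMeasure_real, Real.volume_Ioc]
  have hmε : 0 < m - ε := sub_pos.2 hm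
  constructor
  · have hl : LipschitzOnWith (m - ε)⁻¹.toNNReal (Function.invFun γ) (γ '' Set.Ioc u v) := by
      refine LipschitzOnWith.of_dist_le_mul ?_
      rintro _ ⟨x, hx, rfl⟩ _ ⟨y, hy, rfl⟩
      rw [Function.leftInverse_invFun hinj, Function.leftInverse_invFun hinj,
        Real.coe_toNNReal _ (inv_pos.2 hmε).le, dist_eq_norm (γ x), Real.dist_eq, ← div_eq_inv_mul,
        le_div_iff₀ hmε]
      have := (abs_le.1 (h x hx y hy)).1
      linarith
    have := hl.hausdorffMeasure_image_le (d := 1) zero_le_one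
    rw [← Set.image_comp, Function.invFun_comp hinj, Set.image_id, hvol, ENNReal.rpow_one] at this
    rw [ENNReal.ofReal_mul hmε.le]
    calc _ ≤ ENNReal.ofReal (m - ε) * (ENNReal.ofReal (m - ε)⁻¹ * _) := by gcongr; exact this
      _ = _ := by
        rw [← mul_assoc, ← ENNReal.ofReal_mul hmε.le, mul_inv_cancel₀ hmε.ne', ENNReal.ofReal_one,
          one_mul]
  · have hl : LipschitzOnWith (m + ε).toNNReal γ (Set.Ioc u v) := by
      refine LipschitzOnWith.of_dist_le_mul fun x hx y hy => ?_
      rw [Real.coe_toNNReal _ (by linarith), dist_eq_norm, Real.dist_eq]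
      have := (abs_le.1 (h x hx y hy)).2
      linarith
    have := hl.hausdorffMeasure_image_le (d := 1) zero_le_one
    rwa [hvol, ENNReal.rpow_one, ← ENNReal.ofReal, ← ENNReal.ofReal_mul (by linarith)] at this

lemma HasStrictDerivAt.exists_abs_norm_sub_le {t : ℝ} {m : ℂ} (h : HasStrictDerivAt γ m t)
    {ε : ℝ} (hε : 0 < ε) : ∃ δ > 0, ∀ x ∈ Metric.ball t δ, ∀ y ∈ Metric.ball t δ,
      abs (‖γ x - γ y‖ - ‖m‖ * |x - y|) ≤ ε * |x - y| := by
  have h1 := (hasStrictFDerivAt_iff_isLittleO.1 h.hasStrictFDerivAt).def hε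
  rw [nhds_prod_eq] at h1
  obtain ⟨P, hP, Q, hQ, hPQ⟩ := Filter.eventually_prod_iff.1 h1
  obtain ⟨δ, hδ, hb⟩ := Metric.eventually_nhds_iff_ball.1 (hP.and hQ)
  refine ⟨δ, hδ, fun x hx y hy => ?_⟩
  have := hPQ (hb x hx).1 (hb y hy).2
  simp only [ContinuousLinearMap.toSpanSingleton_apply] at this
  rw [Real.norm_eq_abs] at this
  refine le_trans ?_ this
  have h2 := abs_norm_sub_norm_le (γ x - γ y) ((x - y) • m)
  rwa [norm_smul, Real.norm_eq_abs, mul_comm] at h2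

/-- Arc length of an injective immersed `C¹` curve is its one-dimensional Hausdorff measure. -/
theorem comap_hausdorffMeasure_eq_withDensity (hinj : Function.Injective γ)
    (hγ : ∀ t, HasDerivAt γ (γ' t) t) (hc : Continuous γ') (h0 : ∀ t, γ' t ≠ 0) :
    (Measure.hausdorffMeasure 1).comap γ = volume.withDensity fun t => (‖γ' t‖₊ : ℝ≥0∞) := by
  have hcont : Continuous γ := continuous_iff_continuousAt.2 fun t => (hγ t).continuousAt
  have hemb : MeasurableEmbedding γ := hcont.measurableEmbedding hinj
  set μ := (Measure.hausdorffMeasure 1).comap γ with hμ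
  have happ : ∀ s, μ s = Measure.hausdorffMeasure 1 (γ '' s) := fun s => hemb.comap_apply _ _
  have hstrict : ∀ t, HasStrictDerivAt γ (γ' t) t := fun t =>
    hasStrictDerivAt_of_hasDerivAt_of_continuousAt (.of_forall hγ) hc.continuousAt
  have key : ∀ t, ∀ ε > 0, ε < ‖γ' t‖ → ∃ δ > 0, ∀ u v, u ≤ v → u ∈ Metric.ball t δ →
      v ∈ Metric.ball t δ → ENNReal.ofReal ((‖γ' t‖ - ε) * (v - u)) ≤ μ (Set.Ioc u v) ∧
      μ (Set.Ioc u v) ≤ ENNReal.ofReal ((‖γ' t‖ + ε) * (v - u)) := by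
    intro t ε hε hεm
    obtain ⟨δ, hδ, hb⟩ := (hstrict t).exists_abs_norm_sub_le hε
    refine ⟨δ, hδ, fun u v huv hu hv => ?_⟩
    have hsub : Set.Ioc u v ⊆ Metric.ball t δ := by
      rw [Real.ball_eq_Ioo] at *
      exact fun x hx => ⟨hu.1.trans hx.1, hx.2.trans_lt hv.2⟩
    rw [happ]
    exact hausdorffMeasure_image_Ioc_bounds hinj hε.le hεm fun x hx y hy =>
      hb x (hsub hx) y (hsub hy)
  have hlf : IsLocallyFiniteMeasure μ := by
    refine ⟨fun t => ?_⟩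
    have hpos := norm_pos_iff.2 (h0 t)
    obtain ⟨δ, hδ, hb⟩ := key t (‖γ' t‖ / 2) (by positivity) (by linarith)
    refine ⟨Set.Ioc (t - δ / 2) (t + δ / 2), Ioc_mem_nhds (by linarith) (by linarith), ?_⟩
    refine (hb _ _ (by linarith) ?_ ?_).2.trans_lt ENNReal.ofReal_lt_top
    · rw [Metric.mem_ball, Real.dist_eq, abs_lt]; constructor <;> linarith
    · rw [Metric.mem_ball, Real.dist_eq, abs_lt]; constructor <;> linarith
  have hfin : ∀ a b : ℝ, μ (Set.Ioc a b) ≠ ∞ := fun a b =>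
    ((measure_mono Set.Ioc_subset_Icc_self).trans_lt isCompact_Icc.measure_lt_top).ne
  refine Measure.ext_of_Ioc _ _ fun a b hab => ?_
  -- The distribution function of the pulled-back measure. It starts at `a - 1` so that a two-sided
  -- derivative exists at `a` too; the local bounds squeeze that derivative to `‖γ' t‖`.
  set F : ℝ → ℝ := fun x => μ.real (Set.Ioc (a - 1) x)
  have hF : ∀ u v, a - 1 ≤ u → u ≤ v → F v - F u = μ.real (Set.Ioc u v) := by
    intro u v hu huv
    have : Set.Ioc (a - 1) v = Set.Ioc (a - 1) u ∪ Set.Ioc u v := (Set.Ioc_union_Ioc_eq_Ioc hu huv).symm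
    simp only [F]
    rw [this, measureReal_union (Set.Ioc_disjoint_Ioc_of_le le_rfl) measurableSet_Ioc
      (hfin _ _) (hfin _ _)]
    ring
  have hder : ∀ t ∈ Set.uIcc a b, HasDerivAt F ‖γ' t‖ t := by
    intro t ht
    rw [Set.uIcc_of_le hab.le] at ht
    rw [hasDerivAt_iff_isLittleO, Asymptotics.isLittleO_iff]
    intro c hc'
    have hpos := norm_pos_iff.2 (h0 t)
    set ε := min c (‖γ' t‖ / 2)
    have hε : 0 < ε := by positivity
    have hεc : ε ≤ c := min_le_left _ _
    have hεm : ε < ‖γ' t‖ := (min_le_right _ _).trans_lt (by linarith)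
    obtain ⟨δ, hδ, hb⟩ := key t ε hε hεm
    have hest : ∀ u v, a - 1 ≤ u → u ≤ v → u ∈ Metric.ball t δ → v ∈ Metric.ball t δ →
        |F v - F u - (v - u) * ‖γ' t‖| ≤ c * (v - u) := by
      intro u v hu huv h1 h2
      rw [hF u v hu huv, Measure.real]
      have h3 := hb u v huv h1 h2
      have h4 := ENNReal.toReal_mono (hfin _ _) h3.1
      have h5 := ENNReal.toReal_mono ENNReal.ofReal_ne_top h3.2
      rw [ENNReal.toReal_ofReal (mul_nonneg (by linarith) (by linarith))] at h4 h5
      rw [abs_le]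
      have := mul_le_mul_of_nonneg_right hεc (sub_nonneg.2 huv)
      constructor <;> linarith
    filter_upwards [Metric.ball_mem_nhds t hδ, Ioi_mem_nhds (show a - 1 < t by linarith [ht.1])]
      with x hx hxa
    have hxa : a - 1 ≤ x := le_of_lt hxa
    rw [Real.norm_eq_abs, Real.norm_eq_abs, smul_eq_mul]
    rcases le_total t x with h | h
    · rw [abs_of_nonneg (sub_nonneg.2 h)]
      exact hest t x (by linarith [ht.1]) h (Metric.mem_ball_self hδ) hx
    · have := hest x t hxa h hx (Metric.mem_ball_self hδ)
      rw [abs_of_nonpos (sub_nonpos.2 h), neg_sub]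
      rw [← abs_neg] at this
      convert this using 2
      ring
  have hint := intervalIntegral.integral_eq_sub_of_hasDerivAt hder
    (Continuous.intervalIntegrable (by fun_prop) _ _)
  rw [hF a b (by linarith) hab.le, intervalIntegral.integral_of_le hab.le] at hint
  rw [withDensity_apply _ measurableSet_Ioc, ← ENNReal.ofReal_toReal (hfin a b), ← Measure.real, ← hint,
    ofReal_integral_eq_lintegral_ofReal]
  · simp only [ofReal_norm]; rfl
  · exact (Continuous.integrableOn_Icc (by fun_prop)).mono_set Set.Ioc_subset_Icc_self
  · exact .of_forall fun _ => norm_nonneg _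

lemma setIntegral_range_hausdorffMeasure (hinj : Function.Injective γ)
    (hγ : ∀ t, HasDerivAt γ (γ' t) t) (hc : Continuous γ') (h0 : ∀ t, γ' t ≠ 0) (f : ℂ → ℝ) :
    ∫ ξ in Set.range γ, f ξ ∂(Measure.hausdorffMeasure 1) = ∫ t, ‖γ' t‖ * f (γ t) := by
  have hcont : Continuous γ := continuous_iff_continuousAt.2 fun t => (hγ t).continuousAt
  have hemb : MeasurableEmbedding γ := hcont.measurableEmbedding hinj
  rw [← hemb.map_comap, hemb.integral_map, comap_hausdorffMeasure_eq_withDensity hinj hγ hc h0,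
    integral_withDensity_eq_integral_smul (by fun_prop)]
  rfl

lemma hausdorffMeasure_image_Icc_lt_top (hinj : Function.Injective γ)
    (hγ : ∀ t, HasDerivAt γ (γ' t) t) (hc : Continuous γ') (h0 : ∀ t, γ' t ≠ 0) (a b : ℝ) :
    Measure.hausdorffMeasure 1 (γ '' Set.Icc a b) < ∞ := by
  have hcont : Continuous γ := continuous_iff_continuousAt.2 fun t => (hγ t).continuousAt
  have hemb : MeasurableEmbedding γ := hcont.measurableEmbedding hinj
  rw [← hemb.comap_apply, comap_hausdorffMeasure_eq_withDensity hinj hγ hc h0,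
    withDensity_apply _ measurableSet_Icc]
  have : IntegrableOn (fun t => γ' t) (Set.Icc a b) := hc.integrableOn_Icc
  exact this.2

end ArcLength

/-! ### The divergence theorem over a graph -/

/-- The divergence of a planar vector field `V`. -/
def divergence (V : ℂ → ℂ) (w : ℂ) : ℝ := (fderiv ℝ V w 1).re + (fderiv ℝ V w Complex.I).im

lemma ContDiff.continuous_divergence {V : ℂ → ℂ} (hV : ContDiff ℝ 1 V) :
    Continuous (divergence V) := by
  have := hV.continuous_fderiv (by simp)
  unfold divergence
  fun_prop

lemma HasCompactSupport.divergence {V : ℂ → ℂ} (hV : HasCompactSupport V) :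
    HasCompactSupport (divergence V) := by
  refine (hV.fderiv ℝ).mono' fun w hw => ?_
  refine subset_tsupport _ fun h => hw ?_
  simp [_root_.divergence, h]

lemma isClosedEmbedding_prodMk_const_left (t : ℝ) :
    IsClosedEmbedding (fun s : ℝ => ((t, s) : ℝ × ℝ)) :=
  Function.LeftInverse.isClosedEmbedding (f := Prod.snd) (fun _ => rfl) continuous_snd
    (by fun_prop)

lemma isClosedEmbedding_prodMk_const_right (s : ℝ) :
    IsClosedEmbedding (fun t : ℝ => ((t, s) : ℝ × ℝ)) :=
  Function.LeftInverse.isClosedEmbedding (f := Prod.fst) (fun _ => rfl) continuous_fst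
    (by fun_prop)

/-- The coordinates `(t, s) ↦ (g t + s) + t i` in which the graph of `g` is straight. -/
def graphHomeomorph (g : ℝ → ℝ) (hg : Continuous g) : ℝ × ℝ ≃ₜ ℂ where
  toFun v := ⟨g v.1 + v.2, v.1⟩
  invFun w := (w.im, w.re - g w.im)
  left_inv v := by simp
  right_inv w := by simp
  continuous_toFun := by
    have : (fun v : ℝ × ℝ => (⟨g v.1 + v.2, v.1⟩ : ℂ)) =
        fun v => ((g v.1 + v.2 : ℝ) : ℂ) + (v.1 : ℂ) * Complex.I := by
      ext v; simp [Complex.ext_iff]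
    rw [this]; fun_prop
  continuous_invFun := by fun_prop

lemma graphHomeomorph_apply (g : ℝ → ℝ) (hg : Continuous g) (v : ℝ × ℝ) :
    graphHomeomorph g hg v = ((g v.1 + v.2 : ℝ) : ℂ) + (v.1 : ℂ) * Complex.I := by
  simp [graphHomeomorph, Complex.ext_iff]

/-- A shear, translating each fibre by `g t`, followed by a swap of coordinates. -/
lemma measurePreserving_graphHomeomorph (g : ℝ → ℝ) (hg : Continuous g) :
    MeasurePreserving (graphHomeomorph g hg) volume volume := by
  have h1 : MeasurePreserving (fun v : ℝ × ℝ => (v.1, g v.1 + v.2)) volume volume :=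
    (MeasurePreserving.id volume).skew_product (g := fun a b => g a + b) (by fun_prop)
      (.of_forall fun a => map_add_left_eq_self volume (g a))
  have h2 := Complex.volume_preserving_equiv_real_prod.symm
  have h3 : MeasurePreserving (Prod.swap : ℝ × ℝ → ℝ × ℝ) volume volume :=
    Measure.measurePreserving_swap
  exact (h2.comp h3).comp h1

lemma HasCompactSupport.integral_deriv_eq_zero {f : ℝ → ℝ} (hf : ContDiff ℝ 1 f)
    (hc : HasCompactSupport f) : ∫ t, deriv f t = 0 := by
  have h1 := hc.integral_Ioi_deriv_eq hf 0
  have h2 := hc.integral_Iic_deriv_eq hf 0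
  have hi : Integrable (deriv f) := (hf.continuous_deriv (by simp)).integrable_of_hasCompactSupport hc.deriv
  rw [← intervalIntegral.integral_Iic_add_Ioi hi.integrableOn hi.integrableOn (b := 0), h1, h2]
  simp

/-- The divergence theorem in the region to the right of a graph. -/
theorem setIntegral_divergence_graph {V : ℂ → ℂ} (hV : ContDiff ℝ 1 V) (hc : HasCompactSupport V)
    {g : ℝ → ℝ} (hg : ContDiff ℝ 1 g) :
    ∫ w in {w : ℂ | g w.im < w.re}, divergence V w =
      -∫ t, ((V (g t + t * Complex.I)).re - deriv g t * (V (g t + t * Complex.I)).im) := by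
  set Φ := graphHomeomorph g hg.continuous
  set W : ℝ × ℝ → ℂ := V ∘ Φ with hW
  have hΦ : (Φ : ℝ × ℝ → ℂ) = fun v => ((g v.1 + v.2 : ℝ) : ℂ) + (v.1 : ℂ) * Complex.I :=
    funext (graphHomeomorph_apply g hg.continuous)
  have hdg : Continuous (deriv g) := hg.continuous_deriv (by simp)
  have hcd : ContDiff ℝ 1 Φ := by
    rw [hΦ]
    exact (Complex.ofRealCLM.contDiff.comp ((hg.comp contDiff_fst).add contDiff_snd)).add
      ((Complex.ofRealCLM.contDiff.comp contDiff_fst).mul contDiff_const)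
  have hWc : ContDiff ℝ 1 W := hV.comp hcd
  have hWs : HasCompactSupport W := hc.comp_homeomorph Φ
  have hd1 : ∀ v, HasDerivAt (fun s => W (v.1, s)) (fderiv ℝ V (Φ v) 1) v.2 := by
    intro v
    have h1 : HasDerivAt (fun s => Φ (v.1, s)) 1 v.2 := by
      simp only [hΦ]
      simpa using (((hasDerivAt_id v.2).const_add (g v.1)).ofReal_comp).add_const
        ((v.1 : ℂ) * Complex.I)
    exact ((hV.differentiable (by simp)) (Φ v)).hasFDerivAt.comp_hasDerivAt v.2 h1
  have hd2 : ∀ v, HasDerivAt (fun t => W (t, v.2))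
      ((deriv g v.1) • fderiv ℝ V (Φ v) 1 + fderiv ℝ V (Φ v) Complex.I) v.1 := by
    intro v
    have h1 : HasDerivAt (fun t => Φ (t, v.2)) (((deriv g v.1 : ℝ) : ℂ) + Complex.I) v.1 := by
      simp only [hΦ]
      simpa using ((((hg.differentiable (by simp)) v.1).hasDerivAt.add_const v.2).ofReal_comp).fun_add
        (((hasDerivAt_id v.1).ofReal_comp).mul_const Complex.I)
    have h2 := HasFDerivAt.comp_hasDerivAt (f := fun t => Φ (t, v.2)) v.1
      ((hV.differentiable (by simp)) (Φ v)).hasFDerivAt h1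
    have h3 : (((deriv g v.1 : ℝ) : ℂ) + Complex.I) = (deriv g v.1) • (1 : ℂ) + Complex.I := by simp
    rwa [h3, map_add, map_smul] at h2
  -- In straightened coordinates the divergence is `∂ₛ(Re W - g' Im W) + ∂ₜ(Im W)`. The second term
  -- integrates to zero along full lines; the first leaves the boundary value at `s = 0`.
  set A : ℝ × ℝ → ℝ := fun v => (fderiv ℝ V (Φ v) 1).re - deriv g v.1 * (fderiv ℝ V (Φ v) 1).im
  set B : ℝ × ℝ → ℝ := fun v =>
    ((deriv g v.1) • fderiv ℝ V (Φ v) 1 + fderiv ℝ V (Φ v) Complex.I).im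
  have hAB : ∀ v, divergence V (Φ v) = A v + B v := fun v => by
    simp [A, B, divergence]
    ring
  have hfd : Continuous (fderiv ℝ V) := hV.continuous_fderiv (by simp)
  have hΦc : Continuous Φ := Φ.continuous
  have hfs : HasCompactSupport (fun v => fderiv ℝ V (Φ v)) := (hc.fderiv ℝ).comp_homeomorph Φ
  have hAi : Integrable A := by
    refine Continuous.integrable_of_hasCompactSupport (by fun_prop) (hfs.mono fun v hv h => hv ?_)
    simp [A, h]
  have hBi : Integrable B := by
    refine Continuous.integrable_of_hasCompactSupport (by fun_prop) (hfs.mono fun v hv h => hv ?_)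
    simp [B, h]
  have hpre : Φ ⁻¹' {w : ℂ | g w.im < w.re} = Set.univ ×ˢ Set.Ioi 0 := by
    ext v; simp [hΦ]
  rw [← (measurePreserving_graphHomeomorph g hg.continuous).setIntegral_preimage_emb
    Φ.measurableEmbedding, hpre]
  change ∫ v in _, divergence V (Φ v) = _
  simp_rw [hAB]
  rw [integral_add hAi.integrableOn hBi.integrableOn]
  have hB : ∫ v in Set.univ ×ˢ Set.Ioi (0 : ℝ), B v = 0 := by
    rw [Measure.volume_eq_prod, ← Measure.prod_restrict, Measure.restrict_univ, integral_prod_symm]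
    · refine integral_eq_zero_of_ae (.of_forall fun s => ?_)
      have hl : HasCompactSupport (fun t => (W (t, s)).im) :=
        (hWs.comp_isClosedEmbedding (g := fun t => (t, s)) (isClosedEmbedding_prodMk_const_right s)).comp_left
          Complex.zero_im
      have := hl.integral_deriv_eq_zero (Complex.imCLM.contDiff.comp (hWc.comp (by fun_prop)))
      rw [Pi.zero_apply, ← this]
      refine integral_congr_ae (.of_forall fun t => ?_)
      exact ((Complex.imCLM.hasFDerivAt.comp_hasDerivAt t (hd2 (t, s))).deriv).symm
    · have := hBi.integrableOn (s := Set.univ ×ˢ Set.Ioi (0 : ℝ))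
      rwa [IntegrableOn, Measure.volume_eq_prod, ← Measure.prod_restrict, Measure.restrict_univ] at this
  have hA : ∫ v in Set.univ ×ˢ Set.Ioi (0 : ℝ), A v =
      -∫ t, ((V (g t + t * Complex.I)).re - deriv g t * (V (g t + t * Complex.I)).im) := by
    rw [Measure.volume_eq_prod, ← Measure.prod_restrict, Measure.restrict_univ, integral_prod,
      ← integral_neg]
    · refine integral_congr_ae (.of_forall fun t => ?_)
      dsimp only
      have hl : HasCompactSupport (fun s => W (t, s)) :=
        hWs.comp_isClosedEmbedding (g := fun s => (t, s)) (isClosedEmbedding_prodMk_const_left t)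
      have hl2 : HasCompactSupport (fun s => (W (t, s)).re - deriv g t * (W (t, s)).im) :=
        hl.mono fun s hs h => hs (by simp [h])
      have hcd : ContDiff ℝ 1 (fun s => (W (t, s)).re - deriv g t * (W (t, s)).im) :=
        (Complex.reCLM.contDiff.comp (hWc.comp (by fun_prop))).sub
          (contDiff_const.mul (Complex.imCLM.contDiff.comp (hWc.comp (by fun_prop))))
      have h1 := hl2.integral_Ioi_deriv_eq hcd 0
      have h2 : W (t, 0) = V (g t + t * Complex.I) := by simp [hW, hΦ]
      rw [h2] at h1
      rw [← h1]
      refine integral_congr_ae (.of_forall fun s => ?_)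
      exact (((Complex.reCLM.hasFDerivAt.comp_hasDerivAt s (hd1 (t, s))).sub
        ((Complex.imCLM.hasFDerivAt.comp_hasDerivAt s (hd1 (t, s))).const_mul (deriv g t))).deriv).symm
    · have := hAi.integrableOn (s := Set.univ ×ˢ Set.Ioi (0 : ℝ))
      rwa [IntegrableOn, Measure.volume_eq_prod, ← Measure.prod_restrict, Measure.restrict_univ] at this
  rw [hA, hB, add_zero]

/-- The divergence is invariant under rigid motions. -/
lemma divergence_rigid_motion {V : ℂ → ℂ} {p n w : ℂ} (hn : ‖n‖ = 1)
    (hV : DifferentiableAt ℝ V (p + n * w)) :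
    divergence (fun w => starRingEnd ℂ n * V (p + n * w)) w = divergence V (p + n * w) := by
  have h1 : HasFDerivAt (fun w : ℂ => p + n * w) (n • ContinuousLinearMap.id ℝ ℂ) w := by
    simpa using ((hasFDerivAt_id (𝕜 := ℝ) w).const_mul n).const_add p
  have h2 := (hV.hasFDerivAt.comp w h1).const_mul (starRingEnd ℂ n)
  rw [divergence, HasFDerivAt.fderiv (f := fun w => starRingEnd ℂ n * V (p + n * w)) h2, divergence]
  have hL : ∀ v : ℂ, fderiv ℝ V (p + n * w) v = v.re * fderiv ℝ V (p + n * w) 1 +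
      v.im * fderiv ℝ V (p + n * w) Complex.I := fun v => by
    rw [← Complex.real_smul, ← Complex.real_smul, ← map_smul, ← map_smul, ← map_add]
    simp [Complex.re_add_im]
  have hsq : n.re ^ 2 + n.im ^ 2 = 1 := by
    have := Complex.sq_norm n
    rw [hn, Complex.normSq_apply] at this
    linarith
  simp only [_root_.smul_apply, ContinuousLinearMap.comp_apply,
    ContinuousLinearMap.id_apply, smul_eq_mul, mul_one]
  rw [hL n, hL (n * Complex.I)]
  simp
  linear_combination ((fderiv ℝ V (p + n * w) 1).re + (fderiv ℝ V (p + n * w) Complex.I).im) * hsq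

/-! ### The divergence theorem in a boundary chart -/

/-- The curve `re w = g (im w)` in the coordinates `w = (ξ - p) / n`. -/
def graphCurve (p n : ℂ) (g : ℝ → ℝ) (t : ℝ) : ℂ := p + n * (g t + t * Complex.I)

/-- The unit normal of `graphCurve p n g` that points to the right of the graph. -/
def graphNormal (n : ℂ) (g : ℝ → ℝ) (t : ℝ) : ℂ :=
  n * ((1 - deriv g t * Complex.I) / (Real.sqrt (1 + deriv g t ^ 2) : ℝ))

/-- The coordinate `(ξ - p) / n`, for `‖n‖ = 1`. -/
def chartCoord (p n ξ : ℂ) : ℂ := starRingEnd ℂ n * (ξ - p)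

lemma continuous_chartCoord (p n : ℂ) : Continuous (chartCoord p n) := by
  unfold chartCoord; fun_prop

lemma conj_mul_self_of_norm {n : ℂ} (hn : ‖n‖ = 1) : starRingEnd ℂ n * n = 1 := by
  rw [mul_comm, Complex.mul_conj, Complex.normSq_eq_norm_sq, hn]; simp

lemma chartCoord_add_mul {n : ℂ} (hn : ‖n‖ = 1) (p w : ℂ) : chartCoord p n (p + n * w) = w := by
  rw [chartCoord, add_sub_cancel_left, ← mul_assoc, conj_mul_self_of_norm hn, one_mul]

lemma add_mul_chartCoord {n : ℂ} (hn : ‖n‖ = 1) (p ξ : ℂ) : p + n * chartCoord p n ξ = ξ := by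
  rw [chartCoord, ← mul_assoc, mul_comm n, conj_mul_self_of_norm hn, one_mul, add_sub_cancel]

/-- The rigid motion `w ↦ p + n w`. -/
def rigidMotion (p : ℂ) {n : ℂ} (hn : ‖n‖ = 1) : ℂ ≃ᵢ ℂ where
  toFun w := p + n * w
  invFun := chartCoord p n
  left_inv := chartCoord_add_mul hn p
  right_inv := add_mul_chartCoord hn p
  isometry_toFun := Isometry.of_dist_eq fun x y => by
    rw [dist_add_left, dist_eq_norm, ← mul_sub, norm_mul, hn, one_mul, dist_eq_norm]

lemma measurePreserving_rigidMotion (p : ℂ) {n : ℂ} (hn : ‖n‖ = 1) :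
    MeasurePreserving (rigidMotion p hn) volume volume := by
  have h1 : MeasurePreserving (fun w : ℂ => n * w) volume volume := by
    have := (rotation (⟨n, by simpa [Submonoid.unitSphere] using hn⟩ : Circle)).measurePreserving
    exact this
  exact (measurePreserving_add_left volume p).comp h1

/-- The open square of half-width `r` about `p` with sides parallel to `n` and `i n`. -/
def chartBox (p n : ℂ) (r : ℝ) : Set ℂ :=
  {ξ | |(chartCoord p n ξ).re| < r ∧ |(chartCoord p n ξ).im| < r}

lemma isOpen_chartBox (p n : ℂ) (r : ℝ) : IsOpen (chartBox p n r) := by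
  have := continuous_chartCoord p n
  have h1 : IsOpen {ξ | |(chartCoord p n ξ).re| < r} := isOpen_lt (by fun_prop) continuous_const
  have h2 : IsOpen {ξ | |(chartCoord p n ξ).im| < r} := isOpen_lt (by fun_prop) continuous_const
  exact h1.inter h2

lemma mem_chartBox_self (p n : ℂ) {r : ℝ} (hr : 0 < r) : p ∈ chartBox p n r := by
  simp [chartBox, chartCoord, hr]

lemma isBounded_chartBox (p : ℂ) {n : ℂ} (hn : ‖n‖ = 1) (r : ℝ) :
    Bornology.IsBounded (chartBox p n r) := by
  refine (Metric.isBounded_closedBall (x := p) (r := r + r)).subset fun ξ hξ => ?_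
  have h1 : ‖chartCoord p n ξ‖ = dist ξ p := by
    rw [chartCoord, norm_mul, RCLike.norm_conj, hn, one_mul, dist_eq_norm]
  rw [Metric.mem_closedBall, ← h1]
  exact (Complex.norm_le_abs_re_add_abs_im _).trans (add_le_add hξ.1.le hξ.2.le)

section GraphCurve

variable {p n : ℂ} {g : ℝ → ℝ}

lemma chartCoord_graphCurve (hn : ‖n‖ = 1) (t : ℝ) :
    chartCoord p n (graphCurve p n g t) = g t + t * Complex.I :=
  chartCoord_add_mul hn p _

lemma hasDerivAt_graphCurve (hg : Differentiable ℝ g) (t : ℝ) :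
    HasDerivAt (graphCurve p n g) (n * (deriv g t + Complex.I)) t := by
  have h1 : HasDerivAt (fun t : ℝ => (g t : ℂ) + t * Complex.I) ((deriv g t : ℝ) + Complex.I) t := by
    simpa using ((hg t).hasDerivAt.ofReal_comp).fun_add
      (((hasDerivAt_id t).ofReal_comp).mul_const Complex.I)
  exact (h1.const_mul n).const_add p

lemma graphCurve_injective (hn : ‖n‖ = 1) : Function.Injective (graphCurve p n g) := by
  intro s t h
  have := congrArg (fun ξ => (chartCoord p n ξ).im) h
  simpa [chartCoord_graphCurve hn] using this

lemma norm_deriv_graphCurve (hn : ‖n‖ = 1) (t : ℝ) :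
    ‖n * (deriv g t + Complex.I)‖ = Real.sqrt (1 + deriv g t ^ 2) := by
  rw [norm_mul, hn, one_mul, Complex.norm_def, Complex.normSq_apply]
  simp
  ring_nf

lemma deriv_graphCurve_ne_zero (hn : ‖n‖ = 1) (t : ℝ) : n * (((deriv g t : ℝ) : ℂ) + Complex.I) ≠ 0 := by
  rw [← norm_pos_iff, norm_deriv_graphCurve hn]
  positivity

lemma continuous_graphNormal (hg : Continuous (deriv g)) : Continuous (graphNormal n g) := by
  unfold graphNormal
  refine continuous_const.mul (Continuous.div (by fun_prop) (by fun_prop) fun t => ?_)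
  rw [Complex.ofReal_ne_zero]
  positivity

end GraphCurve

namespace IsBoundaryChart

variable {D : Set ℂ} {p n : ℂ} {g : ℝ → ℝ} {r : ℝ}

lemma differentiable (C : IsBoundaryChart D p n g r) : Differentiable ℝ g :=
  C.contDiff.differentiable (by simp)

lemma continuous_deriv (C : IsBoundaryChart D p n g r) : Continuous (deriv g) :=
  C.contDiff.continuous_deriv (by simp)

lemma mem_iff_of_mem_chartBox (C : IsBoundaryChart D p n g r) {ξ : ℂ} (hξ : ξ ∈ chartBox p n r) :
    ξ ∈ D ↔ g (chartCoord p n ξ).im < (chartCoord p n ξ).re := by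
  rw [← C.mem_iff _ hξ.1 hξ.2, add_mul_chartCoord C.norm_eq_one]

lemma frontier_setOf_graph_lt {g : ℝ → ℝ} (hg : Continuous g) :
    frontier {w : ℂ | g w.im < w.re} = {w : ℂ | w.re = g w.im} := by
  apply Set.Subset.antisymm
  · refine (frontier_lt_subset_eq (by fun_prop) (by fun_prop)).trans fun w hw => ?_
    exact Eq.symm hw
  · intro w hw
    have ho : IsOpen {w : ℂ | g w.im < w.re} := isOpen_lt (by fun_prop) (by fun_prop)
    rw [ho.frontier_eq]
    refine ⟨?_, fun h => (h : g w.im < w.re).ne hw.symm⟩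
    refine mem_closure_of_tendsto (f := fun s : ℝ => w + s) (b := 𝓝[>] 0) ?_ ?_
    · exact ((by fun_prop : Continuous fun s : ℝ => w + s).tendsto' 0 w (by simp)).mono_left
        nhdsWithin_le_nhds
    · filter_upwards [self_mem_nhdsWithin] with s hs
      have : w.re = g w.im := hw
      simpa [← this] using hs

lemma mem_frontier_iff (C : IsBoundaryChart D p n g r) {ξ : ℂ} (hξ : ξ ∈ chartBox p n r) :
    ξ ∈ frontier D ↔ (chartCoord p n ξ).re = g (chartCoord p n ξ).im := by
  have ho := isOpen_chartBox p n r
  set e := (rigidMotion p C.norm_eq_one).symm.toHomeomorph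
  have he : ∀ ξ, e ξ = chartCoord p n ξ := fun _ => rfl
  have h1 : frontier {ξ | g (chartCoord p n ξ).im < (chartCoord p n ξ).re} =
      {ξ | (chartCoord p n ξ).re = g (chartCoord p n ξ).im} := by
    have := e.preimage_frontier {w : ℂ | g w.im < w.re}
    rw [frontier_setOf_graph_lt C.differentiable.continuous] at this
    exact this.symm
  have h2 : D ∩ chartBox p n r =
      {ξ | g (chartCoord p n ξ).im < (chartCoord p n ξ).re} ∩ chartBox p n r := by
    ext ξ
    simp only [Set.mem_inter_iff, Set.mem_ofPred_eq]
    exact and_congr_left fun h => C.mem_iff_of_mem_chartBox h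
  have h3 := frontier_inter_open_inter (s := D) ho
  rw [h2, frontier_inter_open_inter ho, h1] at h3
  have := Set.ext_iff.1 h3 ξ
  simpa [hξ] using this.symm

lemma mem_frontier_iff_exists (C : IsBoundaryChart D p n g r) {ξ : ℂ} (hξ : ξ ∈ chartBox p n r) :
    ξ ∈ frontier D ↔ ξ ∈ Set.range (graphCurve p n g) := by
  rw [C.mem_frontier_iff hξ]
  constructor
  · intro h
    refine ⟨(chartCoord p n ξ).im, ?_⟩
    rw [graphCurve, ← h, Complex.re_add_im, add_mul_chartCoord C.norm_eq_one]
  · rintro ⟨t, rfl⟩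
    simp [chartCoord_graphCurve C.norm_eq_one]

/-- Orthogonality along the graph fixes the normal line, the inward ray fixes the sign and unit
length fixes the scale. In particular the inner unit normal is unique. -/
lemma eq_graphNormal (C : IsBoundaryChart D p n g r) {t : ℝ} {v : ℂ}
    (ht : graphCurve p n g t ∈ chartBox p n r) (hv : IsInnerUnitNormal D (graphCurve p n g t) v) :
    v = graphNormal n g t := by
  obtain ⟨hv1, hv2, hv3⟩ := hv
  have hn := C.norm_eq_one
  set u := starRingEnd ℂ n * v with hu
  have hvu : v = n * u := by rw [hu, ← mul_assoc, mul_comm n, conj_mul_self_of_norm hn, one_mul]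
  have hu1 : ‖u‖ = 1 := by rw [hu, norm_mul, RCLike.norm_conj, hn, hv1, one_mul]
  have hγ := hasDerivAt_graphCurve (p := p) (n := n) C.differentiable t
  have hbox : ∀ᶠ s in 𝓝 t, graphCurve p n g s ∈ chartBox p n r :=
    hγ.continuousAt.eventually ((isOpen_chartBox p n r).mem_nhds ht)
  have htan : u.im = -deriv g t * u.re := by
    have h1 : Tendsto (graphCurve p n g) (𝓝 t) (𝓝[frontier D] graphCurve p n g t) := by
      refine tendsto_nhdsWithin_iff.2 ⟨hγ.continuousAt, ?_⟩
      filter_upwards [hbox] with s hs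
      exact (C.mem_frontier_iff_exists hs).2 ⟨s, rfl⟩
    have h2 : HasDerivAt (fun s => ((graphCurve p n g s - graphCurve p n g t) *
        starRingEnd ℂ v).re) 0 t := by
      rw [hasDerivAt_iff_isLittleO]
      have h3 := (hv2.comp_tendsto h1).trans_isBigO hγ.isBigO_sub
      simpa [Function.comp_def] using h3
    have h4 : HasDerivAt (fun s => ((graphCurve p n g s - graphCurve p n g t) *
        starRingEnd ℂ v).re) (n * ((deriv g t : ℝ) + Complex.I) * starRingEnd ℂ v).re t :=
      Complex.reCLM.hasFDerivAt.comp_hasDerivAt t ((hγ.sub_const _).mul_const _)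
    have h5 := h2.unique h4
    have h6 : n * ((deriv g t : ℝ) + Complex.I) * starRingEnd ℂ v =
        ((deriv g t : ℝ) + Complex.I) * starRingEnd ℂ u := by
      rw [hvu, map_mul]
      linear_combination (((deriv g t : ℝ) + Complex.I) * starRingEnd ℂ u) * conj_mul_self_of_norm hn
    rw [h6] at h5
    simp at h5
    linarith
  have hpos : 0 ≤ u.re := by
    set f : ℝ → ℝ := fun s => g t + s * u.re - g (t + s * u.im)
    have hf : HasDerivAt f (u.re - deriv g t * u.im) 0 := by
      have h1 : HasDerivAt (fun s => t + s * u.im) u.im 0 := by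
        simpa using ((hasDerivAt_id (0 : ℝ)).mul_const u.im).const_add t
      have h2 : HasDerivAt (fun s => g t + s * u.re) u.re 0 := by
        simpa using ((hasDerivAt_id (0 : ℝ)).mul_const u.re).const_add (g t)
      have h3 : HasDerivAt g (deriv g t) (t + 0 * u.im) := by
        simpa using (C.differentiable t).hasDerivAt
      exact h2.sub (HasDerivAt.comp (h₂ := g) (h := fun s => t + s * u.im) 0 h3 h1)
    have hlim := hf.tendsto_slope_zero_right
    have hray : ∀ᶠ s : ℝ in 𝓝[>] 0, graphCurve p n g t + s * v ∈ chartBox p n r := by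
      have : Tendsto (fun s : ℝ => graphCurve p n g t + s * v) (𝓝[>] 0)
          (𝓝 (graphCurve p n g t)) :=
        ((by fun_prop : Continuous fun s : ℝ => graphCurve p n g t + s * v).tendsto' 0 _
          (by simp)).mono_left nhdsWithin_le_nhds
      exact this.eventually ((isOpen_chartBox p n r).mem_nhds ht)
    have h0 : 0 ≤ u.re - deriv g t * u.im := by
      refine ge_of_tendsto hlim ?_
      filter_upwards [hv3, hray, self_mem_nhdsWithin] with s hs1 hs2 hs3
      rw [C.mem_iff_of_mem_chartBox hs2] at hs1
      have hc : chartCoord p n (graphCurve p n g t + s * v) = g t + t * Complex.I + s * u := by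
        rw [← chartCoord_graphCurve (p := p) hn, chartCoord, chartCoord, hu]; ring
      rw [hc] at hs1
      simp at hs1
      have : 0 < s := hs3
      simp only [f, zero_add, smul_eq_mul]
      refine mul_nonneg (inv_nonneg.2 this.le) ?_
      simp
      linarith
    -- With tangency inserted, the weak inequality reads `0 ≤ (1 + g'²) Re u`, which suffices for
    -- the sign.
    rw [htan] at h0
    nlinarith [sq_nonneg (deriv g t)]
  have hq : 0 < 1 + deriv g t ^ 2 := by positivity
  have hre : u.re * Real.sqrt (1 + deriv g t ^ 2) = 1 := by
    have h1 := Complex.sq_norm u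
    rw [hu1, Complex.normSq_apply, htan] at h1
    have h2 : (u.re * Real.sqrt (1 + deriv g t ^ 2)) ^ 2 = 1 := by
      rw [mul_pow, Real.sq_sqrt hq.le]; linarith
    have h3 : 0 ≤ u.re * Real.sqrt (1 + deriv g t ^ 2) := by positivity
    nlinarith
  rw [hvu, graphNormal]
  congr 1
  have hs : ((Real.sqrt (1 + deriv g t ^ 2) : ℝ) : ℂ) ≠ 0 := by
    rw [Complex.ofReal_ne_zero]; positivity
  rw [eq_div_iff hs]
  apply Complex.ext
  · simpa using hre
  · simp [htan]
    linear_combination deriv g t * hre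

/-- The divergence theorem for vector fields supported in a boundary chart. -/
theorem integral_frontier_eq (C : IsBoundaryChart D p n g r) {ν : ℂ → ℂ}
    (hν : ∀ ξ ∈ frontier D, IsInnerUnitNormal D ξ (ν ξ)) {V : ℂ → ℂ} (hV : ContDiff ℝ 1 V)
    (hc : HasCompactSupport V) (hs : tsupport V ⊆ chartBox p n r) (hD : MeasurableSet D) :
    ∫ ξ in frontier D, (V ξ * starRingEnd ℂ (ν ξ)).re ∂(Measure.hausdorffMeasure 1) =
      -∫ ξ in D, divergence V ξ := by
  have hn := C.norm_eq_one
  have hV0 : ∀ ξ ∉ chartBox p n r, V ξ = 0 := fun ξ hξ =>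
    image_eq_zero_of_notMem_tsupport fun h => hξ (hs h)
  have hd0 : ∀ ξ ∉ chartBox p n r, divergence V ξ = 0 := fun ξ hξ => by
    have : fderiv ℝ V ξ = 0 := by
      refine image_eq_zero_of_notMem_tsupport fun h => hξ (hs ?_)
      exact tsupport_fderiv_subset ℝ h
    simp [divergence, this]
  set W : ℂ → ℂ := fun w => starRingEnd ℂ n * V (p + n * w) with hW
  have hWc : ContDiff ℝ 1 W := contDiff_const.mul (hV.comp (by fun_prop))
  have hWs : HasCompactSupport W :=
    (hc.comp_homeomorph (rigidMotion p hn).toHomeomorph).mono fun w hw h => hw (by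
      have : V (p + n * w) = 0 := h
      simp [hW, this])
  -- `V` is supported in the box, where `D` agrees with the region right of the graph, so the whole
  -- region can replace `D`. The same reasoning replaces `frontier D` by the full graph below.
  have hvol : ∫ ξ in D, divergence V ξ = ∫ w in {w : ℂ | g w.im < w.re}, divergence W w := by
    rw [← (measurePreserving_rigidMotion p hn).setIntegral_preimage_emb
      (rigidMotion p hn).toHomeomorph.measurableEmbedding]
    have hgm : MeasurableSet {w : ℂ | g w.im < w.re} :=
      (isOpen_lt (by have := C.differentiable.continuous; fun_prop) (by fun_prop)).measurableSet
    rw [← integral_indicator ((rigidMotion p hn).continuous.measurable hD),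
      ← integral_indicator hgm]
    congr 1
    ext w
    have he : rigidMotion p hn w = p + n * w := rfl
    by_cases hw : p + n * w ∈ chartBox p n r
    · have := C.mem_iff_of_mem_chartBox hw
      rw [chartCoord_add_mul hn] at this
      by_cases h2 : p + n * w ∈ D
      · rw [Set.indicator_of_mem (show w ∈ _ from h2),
          Set.indicator_of_mem (show w ∈ _ from this.1 h2), he,
          divergence_rigid_motion hn (hV.differentiable (by simp) _)]
      · rw [Set.indicator_of_notMem (show w ∉ _ from h2),
          Set.indicator_of_notMem (show w ∉ _ from fun h => h2 (this.2 h))]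
    · rw [Set.indicator_apply_eq_zero.2 fun _ => by rw [he, hd0 _ hw],
        Set.indicator_apply_eq_zero.2 fun _ => by
          rw [divergence_rigid_motion hn (hV.differentiable (by simp) _), hd0 _ hw]]
  rw [hvol, setIntegral_divergence_graph hWc hWs (C.contDiff.of_le (by norm_num)), neg_neg]
  have hfr : ∫ ξ in frontier D, (V ξ * starRingEnd ℂ (ν ξ)).re ∂(Measure.hausdorffMeasure 1) =
      ∫ ξ in Set.range (graphCurve p n g), (V ξ * starRingEnd ℂ (ν ξ)).re
        ∂(Measure.hausdorffMeasure 1) := by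
    have hγm : MeasurableSet (Set.range (graphCurve p n g)) := by
      have hcont : Continuous (graphCurve p n g) :=
        continuous_iff_continuousAt.2 fun t => (hasDerivAt_graphCurve C.differentiable t).continuousAt
      exact (hcont.measurableEmbedding (graphCurve_injective hn)).measurableSet_range
    rw [← integral_indicator isClosed_frontier.measurableSet, ← integral_indicator hγm]
    congr 1
    ext ξ
    by_cases hξ : ξ ∈ chartBox p n r
    · have := C.mem_frontier_iff_exists hξ
      by_cases h : ξ ∈ frontier D
      · rw [Set.indicator_of_mem h, Set.indicator_of_mem (this.1 h)]
      · rw [Set.indicator_of_notMem h, Set.indicator_of_notMem fun h' => h (this.2 h')]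
    · rw [Set.indicator_apply_eq_zero.2 fun _ => by simp [hV0 ξ hξ],
        Set.indicator_apply_eq_zero.2 fun _ => by simp [hV0 ξ hξ]]
  have hcd := C.continuous_deriv
  rw [hfr, setIntegral_range_hausdorffMeasure (graphCurve_injective hn)
    (fun t => hasDerivAt_graphCurve C.differentiable t) (by fun_prop) (deriv_graphCurve_ne_zero hn)]
  refine integral_congr_ae (.of_forall fun t => ?_)
  simp only [norm_deriv_graphCurve hn]
  have hWV : W (g t + t * Complex.I) = starRingEnd ℂ n * V (graphCurve p n g t) := rfl
  rw [hWV]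
  by_cases ht : graphCurve p n g t ∈ chartBox p n r
  -- The arc length factor `√(1 + g'²)` cancels the normalization of the normal.
  · rw [C.eq_graphNormal ht (hν _ ((C.mem_frontier_iff_exists ht).2 ⟨t, rfl⟩)), graphNormal]
    have hpos : 0 < Real.sqrt (1 + deriv g t ^ 2) := by positivity
    set S := Real.sqrt (1 + deriv g t ^ 2)
    have h1 : V (graphCurve p n g t) * starRingEnd ℂ (n * ((1 - deriv g t * Complex.I) / (S : ℂ))) =
        (starRingEnd ℂ n * V (graphCurve p n g t) * (1 + deriv g t * Complex.I)) / (S : ℂ) := by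
      simp only [map_mul, map_div₀, map_sub, map_one, Complex.conj_ofReal, Complex.conj_I]
      ring
    rw [h1, Complex.div_ofReal_re, mul_div_cancel₀ _ hpos.ne']
    simp
    ring
  · simp [hV0 _ ht]

lemma exists_nhdsWithin_hausdorffMeasure_lt_top (C : IsBoundaryChart D p n g r) :
    ∃ s ∈ 𝓝[frontier D] p, Measure.hausdorffMeasure 1 s < ⊤ := by
  have hcd := C.continuous_deriv
  refine ⟨frontier D ∩ chartBox p n r, inter_mem self_mem_nhdsWithin (mem_nhdsWithin_of_mem_nhds
    ((isOpen_chartBox p n r).mem_nhds (mem_chartBox_self p n C.pos))), ?_⟩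
  refine (measure_mono fun ξ hξ => ?_).trans_lt
    (hausdorffMeasure_image_Icc_lt_top (graphCurve_injective (p := p) (g := g) C.norm_eq_one)
    (fun t => hasDerivAt_graphCurve C.differentiable t) (by fun_prop)
    (deriv_graphCurve_ne_zero C.norm_eq_one) (-r) r)
  obtain ⟨t, rfl⟩ := (C.mem_frontier_iff_exists hξ.2).1 hξ.1
  refine ⟨t, abs_le.1 ?_, rfl⟩
  have := hξ.2.2
  rw [chartCoord_graphCurve C.norm_eq_one] at this
  simpa using this.le

lemma normal_eq (C : IsBoundaryChart D p n g r) {ν : ℂ → ℂ}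
    (hν : ∀ ξ ∈ frontier D, IsInnerUnitNormal D ξ (ν ξ)) {ξ : ℂ} (hξ : ξ ∈ frontier D)
    (hb : ξ ∈ chartBox p n r) : ν ξ = graphNormal n g (chartCoord p n ξ).im := by
  obtain ⟨t, rfl⟩ := (C.mem_frontier_iff_exists hb).1 hξ
  rw [C.eq_graphNormal hb (hν _ hξ), chartCoord_graphCurve C.norm_eq_one]
  simp

lemma continuousWithinAt_normal (C : IsBoundaryChart D p n g r) {ν : ℂ → ℂ}
    (hν : ∀ ξ ∈ frontier D, IsInnerUnitNormal D ξ (ν ξ)) (hp : p ∈ frontier D) :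
    ContinuousWithinAt ν (frontier D) p := by
  have hb := (isOpen_chartBox p n r).mem_nhds (mem_chartBox_self p n C.pos)
  have h1 : ContinuousWithinAt (fun ξ => graphNormal n g (chartCoord p n ξ).im) (frontier D) p := by
    have h2 := continuous_graphNormal (n := n) C.continuous_deriv
    have h3 := continuous_chartCoord p n
    exact Continuous.continuousWithinAt (by fun_prop)
  refine h1.congr_of_eventuallyEq ?_ (C.normal_eq hν hp (mem_of_mem_nhds hb))
  filter_upwards [self_mem_nhdsWithin, mem_nhdsWithin_of_mem_nhds hb] with ξ h2 h3
  exact C.normal_eq hν h2 h3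

end IsBoundaryChart

/-! ### The divergence theorem in a bounded `C²` domain -/

section DivergenceTheorem

open scoped Manifold ContDiff

variable {D : Set ℂ} {ν : ℂ → ℂ}

lemma hausdorffMeasure_frontier_lt_top (ho : IsOpen D) (hb : Bornology.IsBounded D)
    (hC : HasC2Boundary D) : Measure.hausdorffMeasure 1 (frontier D) < ⊤ := by
  have hc : IsCompact (frontier D) :=
    hb.isCompact_closure.of_isClosed_subset isClosed_frontier frontier_subset_closure
  refine hc.measure_lt_top_of_nhdsWithin fun p hp => ?_
  obtain ⟨n, g, r, C⟩ := hC.exists_chart ho hp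
  exact C.exists_nhdsWithin_hausdorffMeasure_lt_top

/-- No regularity of `ν` is assumed; on the boundary it is inherited from the charts and makes the
integrands measurable. -/
lemma continuousOn_normal (ho : IsOpen D) (hC : HasC2Boundary D)
    (hν : ∀ ξ ∈ frontier D, IsInnerUnitNormal D ξ (ν ξ)) : ContinuousOn ν (frontier D) := by
  intro p hp
  obtain ⟨n, g, r, C⟩ := hC.exists_chart ho hp
  exact C.continuousWithinAt_normal hν hp

lemma integrableOn_frontier_of_continuousOn (ho : IsOpen D) (hb : Bornology.IsBounded D)
    (hC : HasC2Boundary D) {f : ℂ → ℝ} (hf : ContinuousOn f (frontier D)) :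
    IntegrableOn f (frontier D) (Measure.hausdorffMeasure 1) := by
  have hc : IsCompact (frontier D) :=
    hb.isCompact_closure.of_isClosed_subset isClosed_frontier frontier_subset_closure
  obtain ⟨M, hM⟩ := hc.exists_bound_of_continuousOn hf
  have : IsFiniteMeasure ((Measure.hausdorffMeasure 1).restrict (frontier D)) :=
    ⟨by simpa using hausdorffMeasure_frontier_lt_top ho hb hC⟩
  refine Integrable.of_bound (hf.aestronglyMeasurable isClosed_frontier.measurableSet) M ?_
  filter_upwards [ae_restrict_mem isClosed_frontier.measurableSet] with ξ hξ using hM ξ hξ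

/-- Integration by parts against the constant function 1. -/
lemma integral_divergence_eq_zero {V : ℂ → ℂ} (hV : ContDiff ℝ 1 V) (hc : HasCompactSupport V) :
    ∫ w, divergence V w = 0 := by
  have hfd := hV.continuous_fderiv (by simp)
  have hi : ∀ v, Integrable (fun w => fderiv ℝ V w v) := fun v =>
    Continuous.integrable_of_hasCompactSupport (by fun_prop)
      ((hc.fderiv ℝ).mono fun w hw h => hw (by simp [h]))
  have h0 : ∀ v, ∫ w, fderiv ℝ V w v = 0 := fun v => by
    have := integral_smul_fderiv_eq_neg_fderiv_smul_of_integrable (μ := volume) (𝕜 := ℝ)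
      (f := fun _ : ℂ => (1 : ℝ)) (g := V) (v := v) (by simp) (by simpa using hi v)
      (by simpa using hV.continuous.integrable_of_hasCompactSupport hc) (by simp)
      (fun x _ => hV.differentiable (by simp) x)
    simpa using this
  have hadd := integral_add (hi 1).re (hi Complex.I).im
  simp only [RCLike.re_eq_complex_re, RCLike.im_eq_complex_im] at hadd
  simp only [divergence]
  rw [hadd]
  have h1 := Complex.reCLM.integral_comp_comm (hi 1)
  have h2 := Complex.imCLM.integral_comp_comm (hi Complex.I)
  simp only [Complex.reCLM_apply, Complex.imCLM_apply, h0, Complex.zero_re, Complex.zero_im] at h1 h2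
  rw [h1, h2, add_zero]

lemma contDiff_smul_of_tsupport_subset {φ : ℂ → ℝ} {V : ℂ → ℂ} {U : Set ℂ} (hU : IsOpen U)
    (hφ : ContDiff ℝ 1 φ) (hV : ContDiffOn ℝ 1 V U) (hs : tsupport φ ⊆ U) :
    ContDiff ℝ 1 (fun ξ => φ ξ • V ξ) := by
  rw [contDiff_iff_contDiffAt]
  intro ξ
  by_cases hξ : ξ ∈ tsupport φ
  · exact hφ.contDiffAt.smul (hV.contDiffAt (hU.mem_nhds (hs hξ)))
  · refine (contDiffAt_const (c := (0 : ℂ))).congr_of_eventuallyEq ?_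
    filter_upwards [notMem_tsupport_iff_eventuallyEq.1 hξ] with s hs
    simp [hs]

/-- Near an interior point both sides vanish for fields supported in `D`; near a boundary point a
chart box serves. -/
lemma exists_isOpen_integral_frontier_eq (ho : IsOpen D) (hb : Bornology.IsBounded D)
    (hC : HasC2Boundary D) (hν : ∀ ξ ∈ frontier D, IsInnerUnitNormal D ξ (ν ξ)) {p : ℂ}
    (hp : p ∈ closure D) :
    ∃ O : Set ℂ, IsOpen O ∧ p ∈ O ∧ Bornology.IsBounded O ∧ ∀ W : ℂ → ℂ, ContDiff ℝ 1 W →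
      HasCompactSupport W → tsupport W ⊆ O →
      ∫ ξ in frontier D, (W ξ * starRingEnd ℂ (ν ξ)).re ∂(Measure.hausdorffMeasure 1) =
        -∫ ξ in D, divergence W ξ := by
  by_cases hpD : p ∈ D
  · refine ⟨D, ho, hpD, hb, fun W hW hc hs => ?_⟩
    have h1 : ∫ ξ in D, divergence W ξ = 0 := by
      rw [setIntegral_eq_integral_of_forall_compl_eq_zero, integral_divergence_eq_zero hW hc]
      intro ξ hξ
      have : fderiv ℝ W ξ = 0 :=
        image_eq_zero_of_notMem_tsupport fun h => hξ (hs (tsupport_fderiv_subset ℝ h))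
      simp [divergence, this]
    rw [h1, neg_zero]
    refine setIntegral_eq_zero_of_forall_eq_zero fun ξ hξ => ?_
    rw [ho.frontier_eq] at hξ
    simp [image_eq_zero_of_notMem_tsupport fun h => hξ.2 (hs h)]
  · have hpf : p ∈ frontier D := by rw [ho.frontier_eq]; exact ⟨hp, hpD⟩
    obtain ⟨n, g, r, C⟩ := hC.exists_chart ho hpf
    exact ⟨chartBox p n r, isOpen_chartBox p n r, mem_chartBox_self p n C.pos,
      isBounded_chartBox p C.norm_eq_one r,
      fun W hW hc hs => C.integral_frontier_eq hν hW hc hs ho.measurableSet⟩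

lemma divergence_sum {ι : Type*} {s : Finset ι} {W : ι → ℂ → ℂ} {ξ : ℂ}
    (hW : ∀ i ∈ s, DifferentiableAt ℝ (W i) ξ) :
    divergence (fun ξ => ∑ i ∈ s, W i ξ) ξ = ∑ i ∈ s, divergence (W i) ξ := by
  simp only [divergence]
  rw [fderiv_fun_sum hW]
  simp [Finset.sum_add_distrib]

/-- The divergence theorem in a bounded planar domain with `C²` boundary. -/
theorem integral_frontier_eq_neg_integral_divergence (ho : IsOpen D) (hb : Bornology.IsBounded D)
    (hC : HasC2Boundary D) (hν : ∀ ξ ∈ frontier D, IsInnerUnitNormal D ξ (ν ξ)) {U : Set ℂ}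
    (hU : IsOpen U) (hDU : closure D ⊆ U) {V : ℂ → ℂ} (hV : ContDiffOn ℝ 1 V U) :
    ∫ ξ in frontier D, (V ξ * starRingEnd ℂ (ν ξ)).re ∂(Measure.hausdorffMeasure 1) =
      -∫ ξ in D, divergence V ξ := by
  have hνc := continuousOn_normal ho hC hν
  have hloc := fun p : closure D => exists_isOpen_integral_frontier_eq ho hb hC hν p.2
  choose O hOo hOp hOb hO using hloc
  obtain ⟨t, ht⟩ := hb.isCompact_closure.elim_finite_subcover (fun p => O p ∩ U)
    (fun p => (hOo p).inter hU) fun ξ hξ => Set.mem_iUnion.2 ⟨⟨ξ, hξ⟩, hOp ⟨ξ, hξ⟩, hDU hξ⟩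
  -- The sets are intersected with `U` because `V` is differentiable only there; each `f i • V` then
  -- extends by zero to a `C¹` field on the plane.
  obtain ⟨f, hf⟩ := SmoothPartitionOfUnity.exists_isSubordinate 𝓘(ℝ, ℂ) (s := closure D)
    isClosed_closure (fun i : t => O i ∩ U) (fun i => (hOo i).inter hU) (by
      intro ξ hξ
      obtain ⟨p, hp, hξp⟩ := Set.mem_iUnion₂.1 (ht hξ)
      exact Set.mem_iUnion.2 ⟨⟨p, hp⟩, hξp⟩)
  set W : t → ℂ → ℂ := fun i ξ => f i ξ • V ξ with hWdef
  have hfc : ∀ i, ContDiff ℝ 1 (f i) := fun i => (f i).contMDiff.contDiff.of_le (by norm_cast)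
  have hW : ∀ i, ContDiff ℝ 1 (W i) := fun i =>
    contDiff_smul_of_tsupport_subset hU (hfc i) hV ((hf i).trans Set.inter_subset_right)
  have hts : ∀ i, tsupport (W i) ⊆ tsupport (f i) := fun i => tsupport_smul_subset_left _ _
  have hWc : ∀ i, HasCompactSupport (W i) := fun i =>
    (hOb i).isCompact_closure.of_isClosed_subset (isClosed_tsupport _)
      ((hts i).trans (((hf i).trans Set.inter_subset_left).trans subset_closure))
  have hsum : ∀ ξ ∈ closure D, V ξ = ∑ i, W i ξ := fun ξ hξ => by
    have := f.sum_eq_one hξ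
    rw [finsum_eq_sum_of_fintype] at this
    rw [hWdef, ← Finset.sum_smul, this, one_smul]
  have h1 : ∫ ξ in frontier D, (V ξ * starRingEnd ℂ (ν ξ)).re ∂(Measure.hausdorffMeasure 1) =
      ∑ i, ∫ ξ in frontier D, (W i ξ * starRingEnd ℂ (ν ξ)).re ∂(Measure.hausdorffMeasure 1) := by
    rw [← integral_finsetSum]
    · refine setIntegral_congr_fun isClosed_frontier.measurableSet fun ξ hξ => ?_
      rw [hsum ξ (frontier_subset_closure hξ), Finset.sum_mul, Complex.re_sum]
    · intro i _
      refine integrableOn_frontier_of_continuousOn ho hb hC ?_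
      exact Complex.continuous_re.comp_continuousOn ((hW i).continuous.continuousOn.mul
        (Complex.continuous_conj.comp_continuousOn hνc))
  have h2 : ∫ ξ in D, divergence V ξ = ∑ i, ∫ ξ in D, divergence (W i) ξ := by
    rw [← integral_finsetSum]
    · refine setIntegral_congr_fun ho.measurableSet fun ξ hξ => ?_
      rw [← divergence_sum fun i _ => (hW i).differentiable (by simp) ξ]
      have : V =ᶠ[𝓝 ξ] fun ξ => ∑ i, W i ξ := by
        filter_upwards [ho.mem_nhds hξ] with ζ hζ using hsum ζ (subset_closure hζ)
      rw [divergence, divergence, this.fderiv_eq]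
    · intro i _
      exact ((hW i).continuous_divergence.integrable_of_hasCompactSupport
        (hWc i).divergence).integrableOn
  rw [h1, h2, ← Finset.sum_neg_distrib]
  exact Finset.sum_congr rfl fun i _ => hO i (W i) (hW i) (hWc i)
    ((hts i).trans ((hf i).trans Set.inter_subset_left))

end DivergenceTheorem

/-! ### Boundedness of the planar kernel on a `C²` boundary -/

lemma exists_abs_le_mul_sq {g : ℝ → ℝ} (hg : ContDiff ℝ 2 g) (h0 : g 0 = 0)
    (h1 : deriv g 0 = 0) :
    ∃ K > 0, ∃ δ > 0, ∀ t, |t| < δ → |g t| ≤ K * t ^ 2 ∧ |deriv g t| ≤ K * |t| := by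
  have hd : Differentiable ℝ g := hg.differentiable (by simp)
  have hg' : ContDiff ℝ 1 (deriv g) := ((contDiff_succ_iff_deriv (n := 1)).1 hg).2.2
  have hO := ((hg'.differentiable (by simp)) 0).isBigO_sub
  obtain ⟨K, hK, hb⟩ := hO.exists_pos
  obtain ⟨δ, hδ, hb⟩ := Metric.eventually_nhds_iff_ball.1 hb.bound
  have hder : ∀ t, |t| < δ → |deriv g t| ≤ K * |t| := fun t ht => by
    simpa [h1] using hb t (by simpa using ht)
  refine ⟨K, hK, δ, hδ, fun t ht => ⟨?_, hder t ht⟩⟩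
  have := (convex_closedBall (0 : ℝ) |t|).norm_image_sub_le_of_norm_deriv_le (f := g)
    (C := K * |t|) (fun s _ => hd s) (fun s hs => ?_) (x := 0) (y := t) (by simp) (by simp)
  · rw [h0, sub_zero, sub_zero, Real.norm_eq_abs, Real.norm_eq_abs, mul_assoc, ← sq, sq_abs] at this
    exact this
  · have hs' : |s| ≤ |t| := by simpa using hs
    exact (hder s (hs'.trans_lt ht)).trans (by gcongr)

/-- The double layer kernel of the plane is bounded on a `C²` curve. -/
lemma exists_abs_re_sub_mul_conj_normal_le {D : Set ℂ} {ν : ℂ → ℂ} (ho : IsOpen D)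
    (hC : HasC2Boundary D) (hν : ∀ ξ ∈ frontier D, IsInnerUnitNormal D ξ (ν ξ)) (p : ℂ) :
    ∃ K, ∀ ξ ∈ frontier D, |((ξ - p) * starRingEnd ℂ (ν ξ)).re| ≤ K * ‖ξ - p‖ ^ 2 := by
  -- Away from `p` the trivial bound `‖ξ - p‖` is absorbed using `1 ≤ ‖ξ - p‖ / δ`.
  have hfar : ∀ δ > 0, ∀ ξ ∈ frontier D, δ ≤ ‖ξ - p‖ →
      |((ξ - p) * starRingEnd ℂ (ν ξ)).re| ≤ δ⁻¹ * ‖ξ - p‖ ^ 2 := by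
    intro δ hδ ξ hξ h
    refine (Complex.abs_re_le_norm _).trans ?_
    rw [norm_mul, RCLike.norm_conj, (hν ξ hξ).1, mul_one, ← div_eq_inv_mul, le_div_iff₀ hδ, sq]
    gcongr
  by_cases hp : p ∈ frontier D
  · obtain ⟨n, g, r, C⟩ := hC.exists_chart ho hp
    obtain ⟨K, hK, δ, hδ, hb⟩ := exists_abs_le_mul_sq C.contDiff C.map_zero C.deriv_zero
    have hn := C.norm_eq_one
    have hnear : ∀ᶠ ξ in 𝓝 p, ξ ∈ chartBox p n r ∩ Metric.ball p δ := inter_mem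
      ((isOpen_chartBox p n r).mem_nhds (mem_chartBox_self p n C.pos)) (Metric.ball_mem_nhds p hδ)
    obtain ⟨δ', hδ', hb'⟩ := Metric.eventually_nhds_iff_ball.1 hnear
    refine ⟨max (2 * K) δ'⁻¹, fun ξ hξ => ?_⟩
    rcases lt_or_ge ‖ξ - p‖ δ' with h | h
    · refine le_trans ?_ (mul_le_mul_of_nonneg_right (le_max_left _ _) (sq_nonneg _))
      obtain ⟨h1, h2⟩ := hb' ξ (by rwa [Metric.mem_ball, dist_eq_norm])
      obtain ⟨t, rfl⟩ := (C.mem_frontier_iff_exists h1).1 hξ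
      rw [C.eq_graphNormal h1 (hν _ hξ), graphNormal]
      set S := Real.sqrt (1 + deriv g t ^ 2)
      have hS : 1 ≤ S := Real.one_le_sqrt.2 (by nlinarith [sq_nonneg (deriv g t)])
      have hw : graphCurve p n g t - p = n * (g t + t * Complex.I) := by simp [graphCurve]
      have hnorm : ‖graphCurve p n g t - p‖ ^ 2 = g t ^ 2 + t ^ 2 := by
        rw [hw, norm_mul, hn, one_mul, Complex.sq_norm, Complex.normSq_apply]
        simp
        ring
      have h3 : (graphCurve p n g t - p) *
          starRingEnd ℂ (n * ((1 - deriv g t * Complex.I) / (S : ℂ))) =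
          ((g t + t * Complex.I) * (1 + (deriv g t : ℝ) * Complex.I)) / (S : ℂ) := by
        rw [hw]
        simp only [map_mul, map_div₀, map_sub, map_one, Complex.conj_ofReal, Complex.conj_I]
        linear_combination ((g t + t * Complex.I) * (1 + (deriv g t : ℝ) * Complex.I)) / (S : ℂ) *
          conj_mul_self_of_norm hn
      have ht : |t| < δ := by
        rw [Metric.mem_ball, dist_eq_norm] at h2
        refine lt_of_le_of_lt (abs_le_of_sq_le_sq ?_ (norm_nonneg _)) h2
        rw [hnorm]; nlinarith [sq_nonneg (g t)]
      -- The normal component is `g t - t g' t` up to the factor `1/S`; both terms are `O(t²)` since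
      -- `g` and `g'` vanish at 0.
      have h4 : ((g t + t * Complex.I) * (1 + (deriv g t : ℝ) * Complex.I)).re =
          g t - t * deriv g t := by simp
      rw [h3, Complex.div_ofReal_re, h4, abs_div, abs_of_pos (by linarith : 0 < S), hnorm]
      refine (div_le_self (abs_nonneg _) hS).trans ?_
      obtain ⟨h5, h6⟩ := hb t ht
      have h7 : |t * deriv g t| ≤ K * t ^ 2 := by
        rw [abs_mul, ← sq_abs t]
        nlinarith [abs_nonneg t]
      have h8 := abs_sub (g t) (t * deriv g t)
      nlinarith [sq_nonneg (g t)]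
    · exact (hfar δ' hδ' ξ hξ h).trans
        (mul_le_mul_of_nonneg_right (le_max_right _ _) (sq_nonneg _))
  · have : (frontier D)ᶜ ∈ 𝓝 p := isClosed_frontier.isOpen_compl.mem_nhds hp
    obtain ⟨δ, hδ, hb⟩ := Metric.mem_nhds_iff.1 this
    refine ⟨δ⁻¹, fun ξ hξ => hfar δ hδ ξ hξ (not_lt.1 fun h => ?_)⟩
    exact hb (show ξ ∈ Metric.ball p δ by rwa [Metric.mem_ball, dist_eq_norm]) hξ

/-! ### The approximate identity and its limits -/

/-- The radial probability density `1 / (π (1 + |w|²)²)` of the plane. -/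
def planarBubble (w : ℂ) : ℝ := 1 / (Real.pi * (1 + ‖w‖ ^ 2) ^ 2)

lemma planarBubble_nonneg (w : ℂ) : 0 ≤ planarBubble w := by
  have := Real.pi_pos
  unfold planarBubble; positivity

lemma integrable_planarBubble : Integrable planarBubble := by
  have h := integrable_rpow_neg_one_add_norm_sq (E := ℂ) (μ := volume) (r := 4)
    (by rw [Complex.finrank_real_complex]; norm_num)
  refine (h.const_mul (1 / Real.pi)).congr (.of_forall fun w => ?_)
  have hp : 0 ≤ 1 + ‖w‖ ^ 2 := by positivity
  simp only [planarBubble]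
  rw [show (-4 / 2 : ℝ) = -(2 : ℕ) by norm_num, Real.rpow_neg hp, Real.rpow_natCast]
  field_simp

lemma integral_planarBubble : ∫ w, planarBubble w = 1 := by
  have hpi := Real.pi_pos
  have h := integral_fun_norm_addHaar (volume : Measure ℂ) (fun y : ℝ => 1 / (Real.pi * (1 + y ^ 2) ^ 2))
  -- In polar coordinates the radial integrand has primitive `-1/(2π(1 + y²))`; its increment
  -- `1/(2π)` is multiplied by dimension 2 times the disk area `π`.
  have h1 : ∫ y in Set.Ioi (0 : ℝ), y ^ 1 • (1 / (Real.pi * (1 + y ^ 2) ^ 2)) =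
      0 - -(1 / (2 * Real.pi * (1 + 0 ^ 2))) := by
    refine integral_Ioi_of_hasDerivAt_of_nonneg' (g := fun y => -(1 / (2 * Real.pi * (1 + y ^ 2))))
      (fun y _ => ?_) (fun y hy => ?_) ?_
    · have h0 : 2 * Real.pi * (1 + y ^ 2) ≠ 0 := by positivity
      have h2 : HasDerivAt (fun y : ℝ => 2 * Real.pi * (1 + y ^ 2)) (2 * Real.pi * (2 * y)) y := by
        simpa using ((hasDerivAt_pow 2 y).const_add 1).const_mul (2 * Real.pi)
      have h3 := (h2.inv h0).neg
      have h4 : -(-(2 * Real.pi * (2 * y)) / (2 * Real.pi * (1 + y ^ 2)) ^ 2) =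
          y ^ 1 • (1 / (Real.pi * (1 + y ^ 2) ^ 2)) := by
        rw [smul_eq_mul]
        field_simp
      rw [h4] at h3
      simpa only [one_div] using! h3
    · have : 0 < y := hy
      positivity
    · have h2 : Tendsto (fun y : ℝ => 2 * Real.pi * (1 + y ^ 2)) atTop atTop :=
        (tendsto_atTop_add_const_left _ _ (tendsto_pow_atTop (by simp))).const_mul_atTop (by positivity)
      simpa using h2.inv_tendsto_atTop.neg
  rw [Complex.finrank_real_complex, h1] at h
  change ∫ w : ℂ, 1 / (Real.pi * (1 + ‖w‖ ^ 2) ^ 2) = 1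
  rw [h]
  have : volume.real (Metric.ball (0 : ℂ) 1) = Real.pi := by
    simp [Measure.real, Complex.volume_ball]
  rw [this]
  simp

lemma ae_re_conj_mul_ne_zero {n : ℂ} (hn : n ≠ 0) :
    ∀ᵐ w : ℂ, (starRingEnd ℂ n * w).re ≠ 0 := by
  set L : ℂ →ₗ[ℝ] ℝ := Complex.reLm ∘ₗ LinearMap.mulLeft ℝ (starRingEnd ℂ n)
  have hker : LinearMap.ker L ≠ ⊤ := fun h => by
    have h1 : n ∈ LinearMap.ker L := by rw [h]; trivial
    have h2 : (starRingEnd ℂ n * n).re = 0 := h1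
    rw [mul_comm, Complex.mul_conj, Complex.ofReal_re, Complex.normSq_eq_zero] at h2
    exact hn h2
  filter_upwards [measure_eq_zero_iff_ae_notMem.1
    (Measure.addHaar_submodule (volume : Measure ℂ) _ hker)] with w hw h
  exact hw h

/-- The reflection `w ↦ -w` swaps the two half-planes, and the line between them is null. -/
lemma setIntegral_halfPlane_planarBubble {n : ℂ} (hn : n ≠ 0) :
    ∫ w in {w : ℂ | 0 < (starRingEnd ℂ n * w).re}, planarBubble w = 1 / 2 := by
  set H : Set ℂ := {w : ℂ | 0 < (starRingEnd ℂ n * w).re}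
  set H' : Set ℂ := {w : ℂ | (starRingEnd ℂ n * w).re < 0}
  have hH : MeasurableSet H := (isOpen_lt (by fun_prop) (by fun_prop)).measurableSet
  have hH' : MeasurableSet H' := (isOpen_lt (by fun_prop) (by fun_prop)).measurableSet
  have hsymm : ∫ w in H', planarBubble w = ∫ w in H, planarBubble w := by
    rw [← (Measure.measurePreserving_neg (volume : Measure ℂ)).setIntegral_preimage_emb
      (MeasurableEquiv.neg ℂ).measurableEmbedding]
    have : Neg.neg ⁻¹' H' = H := by
      ext w
      change (starRingEnd ℂ n * -w).re < 0 ↔ 0 < (starRingEnd ℂ n * w).re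
      rw [mul_neg, Complex.neg_re, neg_lt_zero]
    rw [this]
    simp [planarBubble]
  have hcompl : ∫ w in Hᶜ, planarBubble w = ∫ w in H', planarBubble w := by
    refine setIntegral_congr_set ?_
    filter_upwards [ae_re_conj_mul_ne_zero hn] with w hw
    refine propext ?_
    change ¬ (0 < (starRingEnd ℂ n * w).re) ↔ (starRingEnd ℂ n * w).re < 0
    rw [not_lt, le_iff_lt_or_eq, or_iff_left hw]
  have htot := integral_add_compl hH integrable_planarBubble
  rw [hcompl, hsymm, integral_planarBubble] at htot
  linarith

/-- The density `planarBubble` at scale `ε`. -/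
def scaledBubble (ε : ℝ) (w : ℂ) : ℝ := ε ^ 2 / (Real.pi * (‖w‖ ^ 2 + ε ^ 2) ^ 2)

lemma setIntegral_scaledBubble {D : Set ℂ} (hD : MeasurableSet D) (z : ℂ) {ε : ℝ} (hε : 0 < ε) :
    ∫ ξ in D, scaledBubble ε (ξ - z) =
      ∫ w, D.indicator (fun _ => planarBubble w) (z + (ε : ℂ) * w) := by
  have hpi := Real.pi_pos
  have h := Measure.integral_comp_smul (volume : Measure ℂ)
    (fun w => D.indicator (fun ξ => scaledBubble ε (ξ - z)) (z + w)) ε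
  rw [Complex.finrank_real_complex, integral_add_left_eq_self
    (fun ξ => D.indicator (fun ξ => scaledBubble ε (ξ - z)) ξ) z, integral_indicator hD] at h
  have h1 : ∀ w : ℂ, D.indicator (fun _ => planarBubble w) (z + (ε : ℂ) * w) =
      ε ^ 2 * D.indicator (fun ξ => scaledBubble ε (ξ - z)) (z + ε • w) := by
    intro w
    rw [Complex.real_smul]
    by_cases hw : z + (ε : ℂ) * w ∈ D
    · rw [Set.indicator_of_mem hw, Set.indicator_of_mem hw, scaledBubble, planarBubble,
        add_sub_cancel_left, norm_mul, Complex.norm_real, Real.norm_of_nonneg hε.le]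
      field_simp
      ring
    · rw [Set.indicator_of_notMem hw, Set.indicator_of_notMem hw, mul_zero]
  simp_rw [h1]
  rw [integral_const_mul, h, abs_of_pos (by positivity), smul_eq_mul, ← mul_assoc,
    mul_inv_cancel₀ (by positivity), one_mul]

/-- `T` is the blow-up of `D` at `z`. After the substitution `ξ = z + ε w` the bubble is fixed and
only the indicator of the rescaled set varies, dominated by the bubble. -/
lemma tendsto_setIntegral_scaledBubble {D T : Set ℂ} (hD : MeasurableSet D) (hT : MeasurableSet T) (z : ℂ)
    (h : ∀ᵐ w : ℂ, ∀ᶠ ε : ℝ in 𝓝[>] 0, (z + (ε : ℂ) * w ∈ D ↔ w ∈ T)) :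
    Tendsto (fun ε => ∫ ξ in D, scaledBubble ε (ξ - z)) (𝓝[>] 0)
      (𝓝 (∫ w in T, planarBubble w)) := by
  have hcongr : (fun ε : ℝ => ∫ w, D.indicator (fun _ => planarBubble w) (z + (ε : ℂ) * w)) =ᶠ[𝓝[>] 0]
      fun ε => ∫ ξ in D, scaledBubble ε (ξ - z) := by
    filter_upwards [self_mem_nhdsWithin] with ε hε
    exact (setIntegral_scaledBubble hD z hε).symm
  refine Tendsto.congr' hcongr ?_
  rw [← integral_indicator hT]
  refine tendsto_integral_filter_of_dominated_convergence planarBubble (.of_forall fun ε => ?_)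
    (.of_forall fun ε => .of_forall fun w => ?_) integrable_planarBubble ?_
  · have hm : MeasurableSet ((fun w : ℂ => z + (ε : ℂ) * w) ⁻¹' D) :=
      (by fun_prop : Measurable fun w : ℂ => z + (ε : ℂ) * w) hD
    exact integrable_planarBubble.aestronglyMeasurable.indicator hm
  · refine (norm_indicator_le_norm_self _ _).trans ?_
    rw [Real.norm_of_nonneg (planarBubble_nonneg w)]
  · filter_upwards [h] with w hw
    refine tendsto_const_nhds.congr' ?_
    filter_upwards [hw] with ε hε
    by_cases hwT : w ∈ T
    · rw [Set.indicator_of_mem hwT, Set.indicator_of_mem (hε.2 hwT)]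
    · rw [Set.indicator_of_notMem hwT, Set.indicator_of_notMem fun h => hwT (hε.1 h)]

lemma tendsto_add_mul_nhdsGT (z w : ℂ) :
    Tendsto (fun ε : ℝ => z + (ε : ℂ) * w) (𝓝[>] 0) (𝓝 z) :=
  ((by fun_prop : Continuous fun ε : ℝ => z + (ε : ℂ) * w).tendsto' 0 z (by simp)).mono_left
    nhdsWithin_le_nhds

lemma tendsto_setIntegral_scaledBubble_of_mem {D : Set ℂ} (ho : IsOpen D) {z : ℂ} (hz : z ∈ D) :
    Tendsto (fun ε => ∫ ξ in D, scaledBubble ε (ξ - z)) (𝓝[>] 0) (𝓝 1) := by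
  have := tendsto_setIntegral_scaledBubble ho.measurableSet MeasurableSet.univ z (.of_forall fun w => by
    filter_upwards [(tendsto_add_mul_nhdsGT z w).eventually (ho.mem_nhds hz)] with ε hε
    exact ⟨fun _ => trivial, fun _ => hε⟩)
  rwa [setIntegral_univ, integral_planarBubble] at this

lemma tendsto_setIntegral_scaledBubble_of_notMem {D : Set ℂ} (ho : IsOpen D) {z : ℂ}
    (hz : z ∉ closure D) :
    Tendsto (fun ε => ∫ ξ in D, scaledBubble ε (ξ - z)) (𝓝[>] 0) (𝓝 0) := by
  have := tendsto_setIntegral_scaledBubble ho.measurableSet MeasurableSet.empty z (.of_forall fun w => by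
    filter_upwards [(tendsto_add_mul_nhdsGT z w).eventually
      (isClosed_closure.isOpen_compl.mem_nhds hz)] with ε hε
    exact ⟨fun h => (hε (subset_closure h)).elim, fun h => h.elim⟩)
  rwa [setIntegral_empty] at this

/-- The blow-up is the half-plane on the side of `n`: at scale `ε` the graph deviates from its
tangent by `O(ε²)`, less than `ε |Re u|` unless `Re u = 0`, a null set. -/
lemma tendsto_setIntegral_scaledBubble_of_mem_frontier {D : Set ℂ} (ho : IsOpen D)
    (hC : HasC2Boundary D) {z : ℂ} (hz : z ∈ frontier D) :
    Tendsto (fun ε => ∫ ξ in D, scaledBubble ε (ξ - z)) (𝓝[>] 0) (𝓝 (1 / 2)) := by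
  obtain ⟨n, g, r, C⟩ := hC.exists_chart ho hz
  have hn := C.norm_eq_one
  have hn0 : n ≠ 0 := fun h => by simp [h] at hn
  rw [← setIntegral_halfPlane_planarBubble hn0]
  have hmeas : MeasurableSet {w : ℂ | 0 < (starRingEnd ℂ n * w).re} :=
    (isOpen_lt (by fun_prop) (by fun_prop)).measurableSet
  refine tendsto_setIntegral_scaledBubble ho.measurableSet hmeas z ?_
  obtain ⟨K, hK, δ, hδ, hb⟩ := exists_abs_le_mul_sq C.contDiff C.map_zero C.deriv_zero
  filter_upwards [ae_re_conj_mul_ne_zero hn0] with w hw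
  set u := starRingEnd ℂ n * w
  have hsmall : ∀ᶠ ε : ℝ in 𝓝[>] 0, |ε * u.im| < δ ∧ K * (ε * u.im ^ 2) < |u.re| := by
    have h1 : Tendsto (fun ε : ℝ => |ε * u.im|) (𝓝[>] 0) (𝓝 0) :=
      ((by fun_prop : Continuous fun ε : ℝ => |ε * u.im|).tendsto' 0 0 (by simp)).mono_left
        nhdsWithin_le_nhds
    have h2 : Tendsto (fun ε : ℝ => K * (ε * u.im ^ 2)) (𝓝[>] 0) (𝓝 0) :=
      ((by fun_prop : Continuous fun ε : ℝ => K * (ε * u.im ^ 2)).tendsto' 0 0 (by simp)).mono_left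
        nhdsWithin_le_nhds
    exact (h1.eventually_lt_const hδ).and (h2.eventually_lt_const (abs_pos.2 hw))
  filter_upwards [hsmall, self_mem_nhdsWithin, (tendsto_add_mul_nhdsGT z w).eventually
    ((isOpen_chartBox z n r).mem_nhds (mem_chartBox_self z n C.pos))] with ε h1 h2 h3
  have hε : 0 < ε := h2
  have hc : chartCoord z n (z + ε * w) = ε * u := by
    rw [chartCoord, add_sub_cancel_left]; ring
  rw [C.mem_iff_of_mem_chartBox h3, hc, Complex.re_ofReal_mul, Complex.im_ofReal_mul]
  have h4 := abs_le.1 (hb _ h1.1).1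
  have h5 : K * (ε * u.im) ^ 2 < ε * |u.re| := by nlinarith [h1.2]
  change _ ↔ 0 < u.re
  constructor
  · intro h
    by_contra hcon
    have hneg : u.re < 0 := lt_of_le_of_ne (not_lt.1 hcon) hw
    rw [abs_of_neg hneg] at h5
    linarith
  · intro h
    rw [abs_of_pos h] at h5
    linarith

/-! ### The planar double layer integral -/

/-- The regularized gradient `-(ξ - z) / (2π (|ξ - z|² + ε²))`. -/
def regularizedField (z : ℂ) (ε : ℝ) (ξ : ℂ) : ℂ :=
  (-(1 / (2 * Real.pi)) * ((ξ - z).re ^ 2 + (ξ - z).im ^ 2 + ε ^ 2)⁻¹ : ℝ) • (ξ - z)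

lemma contDiff_regularizedField (z : ℂ) {ε : ℝ} (hε : 0 < ε) :
    ContDiff ℝ 1 (regularizedField z ε) := by
  have h1 : ContDiff ℝ 1 (fun ξ : ℂ => (ξ - z).re) :=
    Complex.reCLM.contDiff.comp (contDiff_id.sub contDiff_const)
  have h2 : ContDiff ℝ 1 (fun ξ : ℂ => (ξ - z).im) :=
    Complex.imCLM.contDiff.comp (contDiff_id.sub contDiff_const)
  refine (contDiff_const.mul (ContDiff.inv (((h1.pow 2).add (h2.pow 2)).add contDiff_const)
    fun ξ => ?_)).smul (contDiff_id.sub contDiff_const)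
  positivity

/-- For `x = ξ - z` and `q = |x|² + ε²` the divergence of `x/q` is `2/q - 2|x|²/q² = 2ε²/q²`. -/
lemma divergence_regularizedField (z : ℂ) {ε : ℝ} (hε : 0 < ε) (ξ : ℂ) :
    divergence (regularizedField z ε) ξ = -scaledBubble ε (ξ - z) := by
  have hpi := Real.pi_pos
  have hre : HasFDerivAt (fun ξ : ℂ => (ξ - z).re) Complex.reCLM ξ :=
    Complex.reCLM.hasFDerivAt.comp ξ ((hasFDerivAt_id ξ).sub_const z)
  have him : HasFDerivAt (fun ξ : ℂ => (ξ - z).im) Complex.imCLM ξ :=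
    Complex.imCLM.hasFDerivAt.comp ξ ((hasFDerivAt_id ξ).sub_const z)
  have hq := ((hre.pow 2).add (him.pow 2)).add_const (ε ^ 2)
  have hq0 : (ξ - z).re ^ 2 + (ξ - z).im ^ 2 + ε ^ 2 ≠ 0 := by positivity
  have h := (((hasDerivAt_inv hq0).comp_hasFDerivAt ξ hq).const_mul (-(1 / (2 * Real.pi)))).smul
    ((hasFDerivAt_id (𝕜 := ℝ) ξ).sub_const z)
  have hv : ∀ v : ℂ, fderiv ℝ (regularizedField z ε) ξ v =
      (-(1 / (2 * Real.pi)) * ((ξ - z).re ^ 2 + (ξ - z).im ^ 2 + ε ^ 2)⁻¹ : ℝ) • v +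
      (1 / (2 * Real.pi) * (((ξ - z).re ^ 2 + (ξ - z).im ^ 2 + ε ^ 2) ^ 2)⁻¹ *
        (2 * (ξ - z).re * v.re + 2 * (ξ - z).im * v.im) : ℝ) • (ξ - z) := fun v => by
    rw [HasFDerivAt.fderiv (f := regularizedField z ε) h]
    simp only [Function.comp_apply, Pi.add_apply, add_apply, _root_.smul_apply,
      ContinuousLinearMap.smulRight_apply, ContinuousLinearMap.id_apply, Complex.reCLM_apply,
      Complex.imCLM_apply, id, nsmul_eq_mul, smul_eq_mul]
    congr 2
    push_cast
    ring
  rw [divergence, hv, hv, scaledBubble, Complex.sq_norm, Complex.normSq_apply]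
  simp only [Complex.add_re, Complex.add_im, Complex.smul_re, Complex.smul_im, Complex.one_re,
    Complex.one_im, Complex.I_re, Complex.I_im, smul_eq_mul]
  generalize (ξ - z).re = x at *
  generalize (ξ - z).im = y at *
  have hq1 : x * x + y * y + ε ^ 2 ≠ 0 := by rwa [← sq, ← sq]
  field_simp
  ring

/-- The double layer kernel `-∂_ν log |ξ - z| / 2π` of the plane. -/
def planarDoubleLayer (ν : ℂ → ℂ) (z ξ : ℂ) : ℝ :=
  -(1 / (2 * Real.pi)) * (((ξ - z) * starRingEnd ℂ (ν ξ)).re / ‖ξ - z‖ ^ 2)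

/-- The planar double layer integral is the solid angle of `D` at `z`. -/
theorem integral_planarDoubleLayer {D : Set ℂ} {ν : ℂ → ℂ} (ho : IsOpen D)
    (hb : Bornology.IsBounded D) (hC : HasC2Boundary D)
    (hν : ∀ ξ ∈ frontier D, IsInnerUnitNormal D ξ (ν ξ)) {z : ℂ} {c : ℝ}
    (hc : Tendsto (fun ε => ∫ ξ in D, scaledBubble ε (ξ - z)) (𝓝[>] 0) (𝓝 c)) :
    IntegrableOn (planarDoubleLayer ν z) (frontier D) (Measure.hausdorffMeasure 1) ∧
      ∫ ξ in frontier D, planarDoubleLayer ν z ξ ∂(Measure.hausdorffMeasure 1) = c := by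
  have hpi := Real.pi_pos
  have hfm := isClosed_frontier (s := D).measurableSet
  have hνc := continuousOn_normal ho hC hν
  have hνm : AEStronglyMeasurable ν ((Measure.hausdorffMeasure 1).restrict (frontier D)) :=
    hνc.aestronglyMeasurable hfm
  have hfin : IsFiniteMeasure ((Measure.hausdorffMeasure 1).restrict (frontier D)) :=
    ⟨by simpa using hausdorffMeasure_frontier_lt_top ho hb hC⟩
  obtain ⟨K, hK⟩ := exists_abs_re_sub_mul_conj_normal_le ho hC hν z
  set F : ℝ → ℂ → ℝ := fun ε ξ => -(1 / (2 * Real.pi)) *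
    (((ξ - z) * starRingEnd ℂ (ν ξ)).re / (‖ξ - z‖ ^ 2 + ε ^ 2))
  have hF0 : F 0 = planarDoubleLayer ν z := by
    ext ξ; simp [F, planarDoubleLayer]
  -- The bound is uniform in `ε`: adding `ε²` only enlarges the denominator, and the quadratic bound
  -- on the numerator cancels `‖ξ - z‖²`.
  have hbound : ∀ ε, ∀ ξ ∈ frontier D, ‖F ε ξ‖ ≤ 1 / (2 * Real.pi) * |K| := by
    intro ε ξ hξ
    simp only [F]
    rw [norm_mul, norm_neg, Real.norm_of_nonneg (by positivity : 0 ≤ 1 / (2 * Real.pi))]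
    refine mul_le_mul_of_nonneg_left ?_ (by positivity)
    rw [norm_div, Real.norm_of_nonneg (by positivity : 0 ≤ ‖ξ - z‖ ^ 2 + ε ^ 2), Real.norm_eq_abs]
    refine div_le_of_le_mul₀ (by positivity) (abs_nonneg _) ((hK ξ hξ).trans ?_)
    calc K * ‖ξ - z‖ ^ 2 ≤ |K| * ‖ξ - z‖ ^ 2 := by gcongr; exact le_abs_self K
      _ ≤ _ := by gcongr; nlinarith [sq_nonneg ε]
  have hmeas : ∀ ε, AEStronglyMeasurable (F ε)
      ((Measure.hausdorffMeasure 1).restrict (frontier D)) := by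
    intro ε
    have h1 : AEMeasurable ν ((Measure.hausdorffMeasure 1).restrict (frontier D)) := hνm.aemeasurable
    have h2 : AEMeasurable (fun ξ => starRingEnd ℂ (ν ξ))
        ((Measure.hausdorffMeasure 1).restrict (frontier D)) :=
      Complex.continuous_conj.measurable.comp_aemeasurable h1
    have h3 : AEMeasurable (fun ξ => ((ξ - z) * starRingEnd ℂ (ν ξ)).re)
        ((Measure.hausdorffMeasure 1).restrict (frontier D)) :=
      Complex.measurable_re.comp_aemeasurable
        ((by fun_prop : Measurable fun ξ : ℂ => ξ - z).aemeasurable.mul h2)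
    have h4 : Measurable fun ξ : ℂ => ‖ξ - z‖ ^ 2 + ε ^ 2 := by fun_prop
    exact ((h3.div h4.aemeasurable).const_mul _).aestronglyMeasurable
  have hint : IntegrableOn (planarDoubleLayer ν z) (frontier D) (Measure.hausdorffMeasure 1) := by
    rw [← hF0]
    refine Integrable.of_bound (hmeas 0) (1 / (2 * Real.pi) * |K|) ?_
    filter_upwards [ae_restrict_mem hfm] with ξ hξ using hbound 0 ξ hξ
  refine ⟨hint, ?_⟩
  have hlim : Tendsto (fun ε => ∫ ξ in frontier D, F ε ξ ∂(Measure.hausdorffMeasure 1)) (𝓝[>] 0)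
      (𝓝 (∫ ξ in frontier D, planarDoubleLayer ν z ξ ∂(Measure.hausdorffMeasure 1))) := by
    rw [← hF0]
    refine tendsto_integral_filter_of_dominated_convergence (fun _ => 1 / (2 * Real.pi) * |K|)
      (.of_forall hmeas) (.of_forall fun ε => ?_) (integrable_const _) (.of_forall fun ξ => ?_)
    · filter_upwards [ae_restrict_mem hfm] with ξ hξ using hbound ε ξ hξ
    · by_cases hξ : ξ = z
      · simp [F, hξ]
      · have hne : ‖ξ - z‖ ^ 2 + 0 ^ 2 ≠ 0 := by
          have := norm_pos_iff.2 (sub_ne_zero.2 hξ)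
          positivity
        have : ContinuousAt (fun ε : ℝ => F ε ξ) 0 := by
          simp only [F]
          exact continuousAt_const.mul (continuousAt_const.div (by fun_prop) hne)
        exact this.tendsto.mono_left nhdsWithin_le_nhds
  -- For `ε > 0` the divergence theorem equates the boundary integral with the bubble mass of `D`,
  -- so the two limits agree.
  refine tendsto_nhds_unique (hlim.congr' ?_) hc
  filter_upwards [self_mem_nhdsWithin] with ε hε
  have hε : 0 < ε := hε
  have h1 := integral_frontier_eq_neg_integral_divergence ho hb hC hν isOpen_univ
    (Set.subset_univ _) (contDiff_regularizedField z hε).contDiffOn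
  simp_rw [divergence_regularizedField z hε] at h1
  rw [integral_neg, neg_neg] at h1
  rw [← h1]
  refine integral_congr_ae (.of_forall fun ξ => ?_)
  simp only [F, regularizedField]
  rw [smul_mul_assoc, Complex.smul_re, Complex.sq_norm, Complex.normSq_apply, smul_eq_mul, ← sq,
    ← sq]
  ring

/-! ### The period lattice and the torus -/

section Lattice

variable {τ : ℂ}

lemma mem_periodLattice_iff {w : ℂ} : w ∈ periodLattice τ ↔ ∃ m n : ℤ, w = m + n * τ := by
  simp [periodLattice, AddSubgroup.mem_closure_pair, eq_comm]

lemma ne_of_notMem_periodLattice {w : ℂ} (hw : w ∉ periodLattice τ) (m n : ℤ) :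
    w ≠ m + n * τ := fun h => hw (mem_periodLattice_iff.2 ⟨m, n, h⟩)

lemma isClosed_periodLattice (hτ : 0 < τ.im) : IsClosed (periodLattice τ : Set ℂ) := by
  have h : (periodLattice τ : Set ℂ) =
      (fun w : ℂ => w.im / τ.im) ⁻¹' Set.range ((↑) : ℤ → ℝ) ∩
      (fun w : ℂ => w.re - w.im / τ.im * τ.re) ⁻¹' Set.range ((↑) : ℤ → ℝ) := by
    ext w
    simp only [SetLike.mem_coe, mem_periodLattice_iff, Set.mem_inter_iff, Set.mem_preimage,
      Set.mem_range]
    constructor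
    · rintro ⟨m, n, rfl⟩
      refine ⟨⟨n, ?_⟩, ⟨m, ?_⟩⟩
      · simp [hτ.ne']
      · simp [hτ.ne']
    · rintro ⟨⟨n, hn⟩, ⟨m, hm⟩⟩
      refine ⟨m, n, Complex.ext ?_ ?_⟩
      · rw [← hn] at hm
        simp [hm]
      · rw [eq_div_iff hτ.ne'] at hn
        simp [hn]
  have hZ : IsClosed (Set.range ((↑) : ℤ → ℝ)) := Int.isClosedEmbedding_coe_real.isClosed_range
  rw [h]
  exact (hZ.preimage (by fun_prop)).inter (hZ.preimage (by fun_prop))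

lemma countable_periodLattice (τ : ℂ) : (periodLattice τ : Set ℂ).Countable := by
  refine (Set.countable_range (fun p : ℤ × ℤ => (p.1 + p.2 * τ : ℂ))).mono fun w hw => ?_
  obtain ⟨m, n, rfl⟩ := mem_periodLattice_iff.1 hw
  exact ⟨(m, n), rfl⟩

lemma toTorus_eq_iff {z ξ : ℂ} : toTorus τ z = toTorus τ ξ ↔ z - ξ ∈ periodLattice τ := by
  rw [eq_comm, toTorus, toTorus, QuotientAddGroup.eq, neg_add_eq_sub]

lemma continuous_toTorus (τ : ℂ) : Continuous (toTorus τ) := continuous_quot_mk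

lemma isOpenMap_toTorus (τ : ℂ) : IsOpenMap (toTorus τ) := QuotientAddGroup.isOpenMap_coe

/-- Distance zero gives only inseparability; closedness of the lattice makes the quotient separated.
-/
lemma toTorus_eq_of_dist_eq_zero (hτ : 0 < τ.im) {z ξ : ℂ}
    (h : dist (toTorus τ z) (toTorus τ ξ) = 0) : toTorus τ z = toTorus τ ξ := by
  have : IsClosed (periodLattice τ : Set ℂ) := isClosed_periodLattice hτ
  have : T3Space (FlatTorus τ) := QuotientAddGroup.instT3Space (periodLattice τ)
  exact (Metric.inseparable_iff.2 h).eq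

lemma greenFunction_add_of_mem (hτ : 0 < τ.im) {l : ℂ} (hl : l ∈ periodLattice τ) {z : ℂ}
    (hz : z ∉ periodLattice τ) : greenFunction τ (z + l) = greenFunction τ z := by
  have hadd : ∀ {a b : ℂ}, b ∈ periodLattice τ → a ∉ periodLattice τ → a + b ∉ periodLattice τ :=
    fun hb ha h => ha (by simpa using sub_mem h hb)
  induction hl using AddSubgroup.closure_induction generalizing z with
  | mem x hx =>
    rcases hx with rfl | hx
    · exact greenFunction_add_one hτ z
    · rw [Set.mem_singleton_iff.1 hx]
      exact greenFunction_add_tau hτ (ne_of_notMem_periodLattice hz)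
  | zero => rw [add_zero]
  | add x y hx hy ihx ihy =>
    rw [← add_assoc, ihy (hadd hx hz), ihx hz]
  | neg x hx ih =>
    have := ih (hadd (neg_mem hx) hz)
    rw [← this, neg_add_cancel_right]

lemma doubleLayerKernel_congr (hτ : 0 < τ.im) {z z' ξ : ℂ} (ν : ℂ → ℂ)
    (h : toTorus τ z = toTorus τ z') (hξ : z' - ξ ∉ periodLattice τ) :
    doubleLayerKernel τ ν z ξ = doubleLayerKernel τ ν z' ξ := by
  rw [toTorus_eq_iff] at h
  have : (fun w => greenFunction τ (z - w)) =ᶠ[𝓝 ξ] fun w => greenFunction τ (z' - w) := by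
    have ho : IsOpen {w : ℂ | z' - w ∉ periodLattice τ} :=
      (isClosed_periodLattice hτ).isOpen_compl.preimage (by fun_prop : Continuous fun w : ℂ => z' - w)
    filter_upwards [ho.mem_nhds hξ] with w hw
    rw [← greenFunction_add_of_mem hτ h hw]
    congr 1
    ring
  rw [doubleLayerKernel, doubleLayerKernel, this.fderiv_eq]

end Lattice

/-! ### Splitting the kernel into planar and regular parts -/

/-- Up to a constant, `log ‖f‖` is the real part of `log (f / f w)`; dividing by `f w` keeps the
argument near 1, away from the branch cut. -/
lemma hasFDerivAt_log_norm {f : ℂ → ℂ} {f' w : ℂ} (hf : HasDerivAt f f' w) (h0 : f w ≠ 0) :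
    HasFDerivAt (fun w => Real.log ‖f w‖)
      (Complex.reCLM.comp ((ContinuousLinearMap.toSpanSingleton ℂ (f' / f w)).restrictScalars ℝ)) w := by
  have h1 : HasDerivAt (fun v => Complex.log (f v / f w)) (f' / f w) w := by
    have := (hf.div_const (f w)).clog (by rw [div_self h0]; exact Complex.one_mem_slitPlane)
    simpa [div_self h0] using this
  have h2 := (Complex.reCLM.hasFDerivAt.comp w (h1.hasFDerivAt.restrictScalars ℝ)).const_add
    (Real.log ‖f w‖)
  refine h2.congr_of_eventuallyEq ?_
  filter_upwards [hf.continuousAt.eventually_ne h0] with v hv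
  simp only [Function.comp_apply, Complex.reCLM_apply, Complex.log_re, norm_div]
  rw [Real.log_div (norm_ne_zero_iff.2 hv) (norm_ne_zero_iff.2 h0)]
  ring

/-- The part of the gradient of `ξ ↦ greenFunction τ (z - ξ)` that is regular at `ξ = z`. -/
def regularField (τ z ξ : ℂ) : ℂ :=
  starRingEnd ℂ (1 / (2 * Real.pi) * (deriv (thetaQuotient τ) (z - ξ) / thetaQuotient τ (z - ξ))) -
    ((z - ξ).im / τ.im : ℝ) • Complex.I

lemma doubleLayerKernel_eq {τ : ℂ} (hτ : 0 < τ.im) (ν : ℂ → ℂ) {z ξ : ℂ}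
    (h : z - ξ ∉ periodLattice τ) :
    doubleLayerKernel τ ν z ξ =
      planarDoubleLayer ν z ξ + (regularField τ z ξ * starRingEnd ℂ (ν ξ)).re := by
  have hpi := Real.pi_pos
  set w := z - ξ with hw
  have hθ0 : jacobiThetaOne τ w ≠ 0 := jacobiThetaOne_ne_zero hτ (ne_of_notMem_periodLattice h)
  have hw0 : w ≠ 0 := fun h0 => h (h0 ▸ zero_mem _)
  have hh0 : thetaQuotient τ w ≠ 0 :=
    thetaQuotient_ne_zero hτ (Or.inr (ne_of_notMem_periodLattice h))
  have hθ : HasDerivAt (jacobiThetaOne τ) (thetaQuotient τ w + w * deriv (thetaQuotient τ) w) w := by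
    have h1 := (hasDerivAt_id w).fun_mul (differentiable_thetaQuotient hτ w).hasDerivAt
    rw [funext (jacobiThetaOne_eq_mul_thetaQuotient hτ)]
    simpa using h1
  have hsub : HasFDerivAt (fun ζ : ℂ => z - ζ) (-ContinuousLinearMap.id ℝ ℂ) ξ := by
    simpa using (hasFDerivAt_id (𝕜 := ℝ) ξ).const_sub z
  have hlog := ((hasFDerivAt_log_norm hθ hθ0).comp ξ hsub).const_mul (-(1 / (2 * Real.pi)))
  have him := ((Complex.imCLM.hasFDerivAt.comp ξ hsub).pow 2).mul_const (2 * τ.im)⁻¹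
  have hG := hlog.add him
  rw [doubleLayerKernel, HasFDerivAt.fderiv (f := fun ζ => greenFunction τ (z - ζ)) hG]
  -- The logarithmic derivative of `w h(w)` is `1/w + h'/h`: the pole gives the planar kernel, the
  -- rest belongs to `regularField`.
  have hratio : (thetaQuotient τ w + w * deriv (thetaQuotient τ) w) / jacobiThetaOne τ w =
      1 / w + deriv (thetaQuotient τ) w / thetaQuotient τ w := by
    rw [jacobiThetaOne_eq_mul_thetaQuotient hτ]
    field_simp
  have hplanar : planarDoubleLayer ν z ξ = 1 / (2 * Real.pi) * (1 / w * ν ξ).re := by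
    rw [planarDoubleLayer, norm_sub_rev, ← hw, show ξ - z = -w by rw [hw]; ring, one_div w,
      Complex.inv_def, ← Complex.normSq_eq_norm_sq]
    simp
    field_simp
    ring
  have hreg : (regularField τ z ξ * starRingEnd ℂ (ν ξ)).re =
      1 / (2 * Real.pi) * ((deriv (thetaQuotient τ) w / thetaQuotient τ w) * ν ξ).re -
        w.im / τ.im * (ν ξ).im := by
    rw [regularField, ← hw]
    generalize deriv (thetaQuotient τ) w / thetaQuotient τ w = a
    have hpc : (1 / (2 * Real.pi) : ℂ) = ((1 / (2 * Real.pi) : ℝ) : ℂ) := by push_cast; ring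
    rw [hpc, map_mul, Complex.conj_ofReal, sub_mul, Complex.sub_re, mul_assoc, Complex.re_ofReal_mul,
      smul_mul_assoc, Complex.smul_re]
    simp
  rw [hplanar, hreg, hratio]
  simp only [add_apply, _root_.smul_apply, ContinuousLinearMap.comp_apply, neg_apply,
    ContinuousLinearMap.id_apply, ContinuousLinearMap.coe_restrictScalars',
    ContinuousLinearMap.toSpanSingleton_apply, Complex.reCLM_apply, Complex.imCLM_apply,
    smul_eq_mul, Function.comp_apply]
  rw [← hw]
  generalize deriv (thetaQuotient τ) w / thetaQuotient τ w = a
  generalize 1 / w = c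
  simp only [Complex.neg_re, Complex.neg_im, Complex.mul_re, Complex.add_re, Complex.add_im,
    Nat.add_one_sub_one, pow_one, nsmul_eq_mul, Nat.cast_ofNat]
  field_simp
  ring

lemma contDiffOn_regularField {τ : ℂ} (hτ : 0 < τ.im) (z : ℂ) :
    ContDiffOn ℝ 1 (regularField τ z) {ξ | thetaQuotient τ (z - ξ) ≠ 0} := by
  have hd := differentiable_thetaQuotient hτ
  have ho : IsOpen {ξ | thetaQuotient τ (z - ξ) ≠ 0} :=
    isOpen_ne.preimage (by have := hd.continuous; fun_prop : Continuous fun ξ => thetaQuotient τ (z - ξ))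
  have hd' : Differentiable ℂ (deriv (thetaQuotient τ)) :=
    (hd.contDiff (n := 2)).differentiable_deriv_two
  have h1 : DifferentiableOn ℂ (fun ξ => 1 / (2 * Real.pi) *
      (deriv (thetaQuotient τ) (z - ξ) / thetaQuotient τ (z - ξ)))
      {ξ | thetaQuotient τ (z - ξ) ≠ 0} := by
    intro ξ hξ
    refine DifferentiableAt.differentiableWithinAt ?_
    exact (differentiableAt_const _).mul (DifferentiableAt.div (by fun_prop) (by fun_prop) hξ)
  have h2 : ContDiffOn ℝ 1 (fun ξ => 1 / (2 * Real.pi) *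
      (deriv (thetaQuotient τ) (z - ξ) / thetaQuotient τ (z - ξ)))
      {ξ | thetaQuotient τ (z - ξ) ≠ 0} := (h1.contDiffOn ho).restrict_scalars ℝ
  have h3 : ContDiff ℝ 1 (fun ξ : ℂ => (((z - ξ).im / τ.im : ℝ) • Complex.I)) :=
    ((Complex.imCLM.contDiff.comp (contDiff_const.sub contDiff_id)).div_const _).smul contDiff_const
  exact (Complex.conjCLE.contDiff.comp_contDiffOn h2).sub h3.contDiffOn

/-- The conjugate of a holomorphic function is divergence free by the Cauchy–Riemann equations, so
only the linear term contributes. -/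
lemma divergence_regularField {τ : ℂ} (hτ : 0 < τ.im) {z ξ : ℂ}
    (hξ : thetaQuotient τ (z - ξ) ≠ 0) : divergence (regularField τ z) ξ = 1 / τ.im := by
  have hd := differentiable_thetaQuotient hτ
  have hd' : Differentiable ℂ (deriv (thetaQuotient τ)) :=
    (hd.contDiff (n := 2)).differentiable_deriv_two
  have h1 : DifferentiableAt ℂ (fun ξ => 1 / (2 * Real.pi) *
      (deriv (thetaQuotient τ) (z - ξ) / thetaQuotient τ (z - ξ))) ξ :=
    (differentiableAt_const _).mul (DifferentiableAt.div (by fun_prop) (by fun_prop) hξ)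
  have h2 := Complex.conjCLE.hasFDerivAt.comp ξ (h1.hasDerivAt.hasFDerivAt.restrictScalars ℝ)
  have hsub : HasFDerivAt (fun ζ : ℂ => z - ζ) (-ContinuousLinearMap.id ℝ ℂ) ξ := by
    simpa using (hasFDerivAt_id (𝕜 := ℝ) ξ).const_sub z
  have h3 := ((Complex.imCLM.hasFDerivAt.comp ξ hsub).mul_const (τ.im)⁻¹).smul_const Complex.I
  have h4 := h2.sub h3
  rw [divergence, HasFDerivAt.fderiv (f := regularField τ z) h4]
  simp

/-! ### Exceptional points and principal values -/

lemma hausdorffMeasure_one_eq_zero_of_countable {s : Set ℂ} (hs : s.Countable) :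
    (Measure.hausdorffMeasure 1 : Measure ℂ) s = 0 := by
  have := Measure.nullSingletonClass_hausdorff ℂ (d := 1) one_pos
  exact hs.measure_zero _

lemma countable_setOf_toTorus_eq (τ z : ℂ) : {ξ | toTorus τ z = toTorus τ ξ}.Countable := by
  refine ((countable_periodLattice τ).image fun l => z - l).mono fun ξ hξ => ?_
  exact ⟨z - ξ, toTorus_eq_iff.1 hξ, by ring⟩

/-- The kernel identities can fail only where `ξ` is congruent to `z`; such points are countable,
hence null for arc length. -/
lemma ae_toTorus_ne (τ z : ℂ) (Γ : Set ℂ) :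
    ∀ᵐ ξ ∂(Measure.hausdorffMeasure 1).restrict Γ, toTorus τ z ≠ toTorus τ ξ :=
  ae_restrict_of_ae (measure_eq_zero_iff_ae_notMem.1
    (hausdorffMeasure_one_eq_zero_of_countable (countable_setOf_toTorus_eq τ z)))

/-- An absolutely convergent double layer integral is also a principal value. -/
lemma HasDoubleLayerIntegral.hasPV {τ : ℂ} (hτ : 0 < τ.im) {ν : ℂ → ℂ} {Γ : Set ℂ} {z : ℂ} {c : ℝ}
    (h : HasDoubleLayerIntegral τ ν Γ z c) :
    HasPVDoubleLayerIntegral τ ν Γ z c := by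
  have hcont : Continuous fun ξ => dist (toTorus τ z) (toTorus τ ξ) :=
    continuous_const.dist (continuous_toTorus τ)
  have hsub : ∀ ε, excised τ Γ z ε ⊆ Γ := fun ε ξ hξ => hξ.1
  refine ⟨fun ε _ => h.1.mono_set (hsub ε), ?_⟩
  have hm : ∀ ε, MeasurableSet {ξ | ε < dist (toTorus τ z) (toTorus τ ξ)} := fun ε =>
    (isOpen_lt continuous_const hcont).measurableSet
  have heq : ∀ ε, ∫ ξ in excised τ Γ z ε, doubleLayerKernel τ ν z ξ ∂(Measure.hausdorffMeasure 1) =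
      ∫ ξ in Γ, {ξ | ε < dist (toTorus τ z) (toTorus τ ξ)}.indicator (doubleLayerKernel τ ν z) ξ
        ∂(Measure.hausdorffMeasure 1) := fun ε => by
    rw [setIntegral_indicator (hm ε)]
    rfl
  simp_rw [heq]
  rw [← h.2]
  refine tendsto_integral_filter_of_dominated_convergence (fun ξ => ‖doubleLayerKernel τ ν z ξ‖)
    (.of_forall fun ε => h.1.aestronglyMeasurable.indicator (hm ε))
    (.of_forall fun ε => .of_forall fun ξ => norm_indicator_le_norm_self _ _) h.1.norm ?_
  filter_upwards [ae_toTorus_ne τ z Γ] with ξ hξ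
  refine tendsto_const_nhds.congr' ?_
  have hpos : 0 < dist (toTorus τ z) (toTorus τ ξ) :=
    lt_of_le_of_ne dist_nonneg fun h0 => hξ (toTorus_eq_of_dist_eq_zero hτ h0.symm)
  filter_upwards [nhdsWithin_le_nhds (Iio_mem_nhds hpos)] with ε hε
  rw [Set.indicator_of_mem (show ξ ∈ _ from hε)]

/-- This allows `z` to be replaced by its representative in the closure of the hole. -/
lemma HasDoubleLayerIntegral.congr_toTorus {τ : ℂ} (hτ : 0 < τ.im) {ν : ℂ → ℂ} {Γ : Set ℂ}
    {z z' : ℂ} {c : ℝ} (hz : toTorus τ z' = toTorus τ z) (h : HasDoubleLayerIntegral τ ν Γ z' c) :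
    HasDoubleLayerIntegral τ ν Γ z c := by
  have hae : doubleLayerKernel τ ν z' =ᵐ[(Measure.hausdorffMeasure 1).restrict Γ]
      doubleLayerKernel τ ν z := by
    filter_upwards [ae_toTorus_ne τ z Γ] with ξ hξ
    exact doubleLayerKernel_congr hτ ν hz fun h => hξ (toTorus_eq_iff.2 h)
  exact ⟨h.1.congr hae, by rw [← integral_congr_ae hae, h.2]⟩

/-! ### One hole -/

section Hole

variable {τ : ℂ} {D : Set ℂ} {ν : ℂ → ℂ}

/-- The double layer integral over the boundary of one hole, where `c` is the solid angle of the
hole at `z`. -/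
lemma hasDoubleLayerIntegral_frontier (hτ : 0 < τ.im) (ho : IsOpen D) (hb : Bornology.IsBounded D)
    (hC : HasC2Boundary D) (hν : ∀ ξ ∈ frontier D, IsInnerUnitNormal D ξ (ν ξ)) {z : ℂ} {c : ℝ}
    (hsep : ∀ ξ ∈ closure D, toTorus τ z = toTorus τ ξ → ξ = z)
    (hc : Tendsto (fun ε => ∫ ξ in D, scaledBubble ε (ξ - z)) (𝓝[>] 0) (𝓝 c)) :
    HasDoubleLayerIntegral τ ν (frontier D) z (c - volume.real D / τ.im) := by
  obtain ⟨hi, hint⟩ := integral_planarDoubleLayer ho hb hC hν hc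
  set U : Set ℂ := {ξ | thetaQuotient τ (z - ξ) ≠ 0}
  have hU : IsOpen U := isOpen_ne.preimage (by
    have := (differentiable_thetaQuotient hτ).continuous
    fun_prop : Continuous fun ξ => thetaQuotient τ (z - ξ))
  -- By `hsep` the only lattice value that `z - ξ` can take on the closure is 0, where
  -- `thetaQuotient` does not vanish.
  have hDU : closure D ⊆ U := fun ξ hξ => by
    refine thetaQuotient_ne_zero hτ ?_
    by_cases h : z - ξ ∈ periodLattice τ
    · left; rw [hsep ξ hξ (toTorus_eq_iff.2 h), sub_self]
    · exact Or.inr (ne_of_notMem_periodLattice h)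
  have hVc := contDiffOn_regularField hτ z
  have hV := integral_frontier_eq_neg_integral_divergence ho hb hC hν hU hDU hVc
  have hdiv : ∫ ξ in D, divergence (regularField τ z) ξ = volume.real D / τ.im := by
    rw [setIntegral_congr_fun ho.measurableSet fun ξ hξ =>
      divergence_regularField hτ (hDU (subset_closure hξ))]
    simp [div_eq_mul_inv]
  rw [hdiv] at hV
  have hVi : IntegrableOn (fun ξ => (regularField τ z ξ * starRingEnd ℂ (ν ξ)).re) (frontier D)
      (Measure.hausdorffMeasure 1) :=
    integrableOn_frontier_of_continuousOn ho hb hC (Complex.continuous_re.comp_continuousOn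
      ((hVc.continuousOn.mono (frontier_subset_closure.trans hDU)).mul
        (Complex.continuous_conj.comp_continuousOn (continuousOn_normal ho hC hν))))
  have hae : (fun ξ => planarDoubleLayer ν z ξ + (regularField τ z ξ * starRingEnd ℂ (ν ξ)).re)
      =ᵐ[(Measure.hausdorffMeasure 1).restrict (frontier D)] doubleLayerKernel τ ν z := by
    filter_upwards [ae_toTorus_ne τ z (frontier D)] with ξ hξ
    exact (doubleLayerKernel_eq hτ ν fun h => hξ (toTorus_eq_iff.2 h)).symm
  exact ⟨(hi.add hVi).congr hae, by rw [← integral_congr_ae hae, integral_add hi hVi, hint, hV]; ring⟩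

lemma closure_toTorus_image (hτ : 0 < τ.im) (hb : Bornology.IsBounded D) :
    closure (toTorus τ '' D) = toTorus τ '' closure D := by
  have : IsClosed (periodLattice τ : Set ℂ) := isClosed_periodLattice hτ
  have : T3Space (FlatTorus τ) := QuotientAddGroup.instT3Space (periodLattice τ)
  exact subset_antisymm (closure_minimal (Set.image_mono subset_closure)
    (hb.isCompact_closure.image (continuous_toTorus τ)).isClosed)
    (image_closure_subset_closure_image (continuous_toTorus τ))

lemma frontier_toTorus_image (ho : IsOpen D) :
    frontier (toTorus τ '' D) = closure (toTorus τ '' D) \ toTorus τ '' D :=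
  (isOpenMap_toTorus τ D ho).frontier_eq

variable (hτ : 0 < τ.im) (ho : IsOpen D) (hb : Bornology.IsBounded D) (hC : HasC2Boundary D)
  (hinj : Set.InjOn (toTorus τ) (closure D)) (hν : ∀ ξ ∈ frontier D, IsInnerUnitNormal D ξ (ν ξ))
  {z : ℂ}
include hτ ho hb hC hν

lemma hasDoubleLayerIntegral_of_notMem_closure (hz : toTorus τ z ∉ closure (toTorus τ '' D)) :
    HasDoubleLayerIntegral τ ν (frontier D) z (-(volume.real D / τ.im)) := by
  rw [closure_toTorus_image hτ hb] at hz
  have h := hasDoubleLayerIntegral_frontier hτ ho hb hC hν (z := z) (c := 0)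
    (fun ξ hξ h => (hz ⟨ξ, hξ, h.symm⟩).elim)
    (tendsto_setIntegral_scaledBubble_of_notMem ho fun h => hz ⟨z, h, rfl⟩)
  rwa [zero_sub] at h

include hinj

lemma hasDoubleLayerIntegral_of_mem (hz : toTorus τ z ∈ toTorus τ '' D) :
    HasDoubleLayerIntegral τ ν (frontier D) z (1 - volume.real D / τ.im) := by
  obtain ⟨z', hz', hzz'⟩ := hz
  exact (hasDoubleLayerIntegral_frontier hτ ho hb hC hν
    (fun ξ hξ h => hinj hξ (subset_closure hz') h.symm)
    (tendsto_setIntegral_scaledBubble_of_mem ho hz')).congr_toTorus hτ hzz'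

lemma hasDoubleLayerIntegral_of_mem_frontier (hz : toTorus τ z ∈ frontier (toTorus τ '' D)) :
    HasDoubleLayerIntegral τ ν (frontier D) z (1 / 2 - volume.real D / τ.im) := by
  rw [frontier_toTorus_image ho, closure_toTorus_image hτ hb] at hz
  obtain ⟨⟨z', hz', hzz'⟩, hz2⟩ := hz
  have hf : z' ∈ frontier D := by
    rw [ho.frontier_eq]
    exact ⟨hz', fun h => hz2 ⟨z', h, hzz'⟩⟩
  exact (hasDoubleLayerIntegral_frontier hτ ho hb hC hν
    (fun ξ hξ h => hinj hξ hz' h.symm)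
    (tendsto_setIntegral_scaledBubble_of_mem_frontier ho hC hf)).congr_toTorus hτ hzz'

end Hole

/-! ### Several holes -/

section HoleFamily

variable {τ : ℂ} {M : ℕ} {D : Fin M → Set ℂ} {ν : ℂ → ℂ}

lemma closure_holeUnion : closure (holeUnion τ D) = ⋃ j, closure (toTorus τ '' D j) :=
  closure_iUnion_of_finite _

lemma IsHoleFamily.disjoint_frontier (hD : IsHoleFamily τ D) {i j : Fin M} (hij : i ≠ j) :
    Disjoint (frontier (D i)) (frontier (D j)) := by
  rw [Set.disjoint_left]
  intro ξ hi hj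
  have hsub : ∀ k, ξ ∈ frontier (D k) → toTorus τ ξ ∈ closure (toTorus τ '' D k) := fun k hk =>
    image_closure_subset_closure_image (continuous_toTorus τ) ⟨ξ, frontier_subset_closure hk, rfl⟩
  exact Set.disjoint_left.1 (hD.disjoint_closure i j hij) (hsub i hi) (hsub j hj)

lemma IsHoleFamily.hasDoubleLayerIntegral_iUnion (hD : IsHoleFamily τ D) {z : ℂ} {c : Fin M → ℝ}
    (h : ∀ j, HasDoubleLayerIntegral τ ν (frontier (D j)) z (c j - volume.real (D j) / τ.im)) :
    HasDoubleLayerIntegral τ ν (⋃ j, frontier (D j)) z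
      (∑ j, c j - (∑ j, volume.real (D j)) / τ.im) := by
  refine ⟨integrableOn_finite_iUnion.2 fun j => (h j).1, ?_⟩
  rw [integral_iUnion_fintype (fun j => isClosed_frontier.measurableSet)
    (fun i j hij => hD.disjoint_frontier hij) fun j => (h j).1]
  simp_rw [(h _).2]
  rw [Finset.sum_sub_distrib, Finset.sum_div]

lemma IsHoleFamily.notMem_closure_of_ne (hD : IsHoleFamily τ D) {i j : Fin M} (hij : j ≠ i)
    {x : FlatTorus τ} (hx : x ∈ closure (toTorus τ '' D i)) : x ∉ closure (toTorus τ '' D j) :=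
  Set.disjoint_right.1 (hD.disjoint_closure j i hij) hx

/-- The closures are disjoint, so `z` lies outside all other closed holes and these contribute area
terms only. -/
lemma IsHoleFamily.hasDoubleLayerIntegral_iUnion_of_mem_closure (hτ : 0 < τ.im)
    (hD : IsHoleFamily τ D) (hν : ∀ j, ∀ ξ ∈ frontier (D j), IsInnerUnitNormal (D j) ξ (ν ξ))
    {z : ℂ} {c : ℝ} (i : Fin M) (hz : toTorus τ z ∈ closure (toTorus τ '' D i))
    (h : HasDoubleLayerIntegral τ ν (frontier (D i)) z (c - volume.real (D i) / τ.im)) :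
    HasDoubleLayerIntegral τ ν (⋃ j, frontier (D j)) z
      (c - (∑ j, volume.real (D j)) / τ.im) := by
  have := hD.hasDoubleLayerIntegral_iUnion (c := fun j => if j = i then c else 0) (z := z) (ν := ν)
    fun j => by
      by_cases hj : j = i
      · subst hj
        simpa using h
      · have := hasDoubleLayerIntegral_of_notMem_closure hτ (hD.isOpen j) (hD.isBounded j)
          (hD.hasC2Boundary j) (hν j) (hD.notMem_closure_of_ne hj hz)
        simpa [hj] using this
  simpa using this

end HoleFamily

theorem mainTheorem5 (τ : ℂ) (hτ : 0 < τ.im) {M : ℕ} (D : Fin M → Set ℂ)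
    (hD : IsHoleFamily τ D) (ν : ℂ → ℂ)
    (hν : ∀ j, ∀ ξ ∈ frontier (D j), IsInnerUnitNormal (D j) ξ (ν ξ)) :
    (∀ (j : Fin M) (z : ℂ),
      (toTorus τ z ∉ closure (toTorus τ '' D j) →
        HasDoubleLayerIntegral τ ν (frontier (D j)) z (-(volume.real (D j) / τ.im))) ∧
      (toTorus τ z ∈ toTorus τ '' D j →
        HasDoubleLayerIntegral τ ν (frontier (D j)) z (1 - volume.real (D j) / τ.im)) ∧
      (toTorus τ z ∈ frontier (toTorus τ '' D j) →
        HasPVDoubleLayerIntegral τ ν (frontier (D j)) z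
          (1 / 2 - volume.real (D j) / τ.im))) ∧
    (∀ z : ℂ,
      (toTorus τ z ∈ puncturedTorus τ D →
        HasDoubleLayerIntegral τ ν (⋃ j, frontier (D j)) z
          (-((∑ j, volume.real (D j)) / τ.im))) ∧
      (toTorus τ z ∈ holeUnion τ D →
        HasDoubleLayerIntegral τ ν (⋃ j, frontier (D j)) z
          (1 - (∑ j, volume.real (D j)) / τ.im)) ∧
      (toTorus τ z ∈ frontier (puncturedTorus τ D) →
        HasPVDoubleLayerIntegral τ ν (⋃ j, frontier (D j)) z
          (1 / 2 - (∑ j, volume.real (D j)) / τ.im))) := by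
  have hout := fun j z => hasDoubleLayerIntegral_of_notMem_closure (z := z) hτ (hD.isOpen j)
    (hD.isBounded j) (hD.hasC2Boundary j) (hν j)
  have hin := fun j z => hasDoubleLayerIntegral_of_mem (z := z) hτ (hD.isOpen j)
    (hD.isBounded j) (hD.hasC2Boundary j) (hD.injOn_closure j) (hν j)
  have hfr := fun j z => hasDoubleLayerIntegral_of_mem_frontier (z := z) hτ (hD.isOpen j)
    (hD.isBounded j) (hD.hasC2Boundary j) (hD.injOn_closure j) (hν j)
  refine ⟨fun j z => ⟨hout j z, hin j z, fun h => (hfr j z h).hasPV hτ⟩, fun z => ⟨fun h => ?_,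
    fun h => ?_, fun h => ?_⟩⟩
  · rw [puncturedTorus, closure_holeUnion] at h
    have := hD.hasDoubleLayerIntegral_iUnion (c := fun _ => 0) (z := z) (ν := ν) fun j => by
      rw [zero_sub]
      exact hout j z fun hj => h (Set.mem_iUnion.2 ⟨j, hj⟩)
    simpa using this
  · obtain ⟨i, hi⟩ := Set.mem_iUnion.1 h
    exact hD.hasDoubleLayerIntegral_iUnion_of_mem_closure hτ hν i (subset_closure hi) (hin i z hi)
  · have ho : IsOpen (holeUnion τ D) :=
      isOpen_iUnion fun j => isOpenMap_toTorus τ _ (hD.isOpen j)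
    rw [puncturedTorus, frontier_compl] at h
    -- The frontier of `Ω` is that of the closed union, which lies in the frontier of the union; `z`
    -- is thus in some closed hole but in no open one.
    have h1 := frontier_closure_subset h
    rw [ho.frontier_eq, closure_holeUnion] at h1
    obtain ⟨i, hi⟩ := Set.mem_iUnion.1 h1.1
    refine (hD.hasDoubleLayerIntegral_iUnion_of_mem_closure hτ hν i hi (hfr i z ?_)).hasPV hτ
    rw [frontier_toTorus_image (hD.isOpen i)]
    exact ⟨hi, fun h => h1.2 (Set.mem_iUnion.2 ⟨i, h⟩)⟩

end
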